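/- Theorem 1.1. For integers $r\ge 1$, $t\ge 2$ let $\mathcal J(r,t)$ be the class of all finite $rt^2$-uniform hypergraphs $H$ (every edge has exactly $rt^2$ vertices, no repeated edges) such that for all edges $e,f$ of $H$ the size $|e\cap f|$ is divisible by $t$ or is at least $rt(t-1)$. Write $e(H)$ for the number of edges and $\Delta(H)$ for the maximum vertex degree of $H$. A thick clique on an $n$-element vertex set $V$ is obtained by choosing $\lfloor n/t\rfloor$ pairwise disjoint $t$-subsets of $V$, called teams, and taking as edges exactly the unions of $rt$ distinct teams. Let $r\ge 1$ and $t\ge 2$ be integers. (a) There exists an $n_0=n_0(r,t)$ such that every $H\in\mathcal J(r,t)$ with $n\ge n_0$ vertices and at least $\binom{\lfloor n/t\rfloor}{rt}+1$ edges satisfies $\Delta(H)\ge e(H)/(3t)$. (b) On the other hand, for every $n\ge rt^2$ there is a thick clique on every $n$-element vertex set, and every thick clique $H_0$ on $n$ vertices belongs to $\mathcal J(r,t)$, has exactly $\binom{\lfloor n/t\rfloor}{rt}$ edges, and has maximum degree $\Delta(H_0)=\binom{\lfloor n/t\rfloor-1}{rt-1}$. (c) In particular the threshold in (a) is sharp: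 $n_0$ can be chosen so that, in addition, $\Delta(H_0)<e(H_0)/(3t)$ for every thick clique $H_0$ on $n\ge n_0$ vertices. -/

import Mathlib

section Defs

/-- A (simple, finite) hypergraph on the vertex set `V` is identified with its finite set of edges
`H : Finset (Finset V)`.  `IsJ r t H` says that `H` is an `rt²`-uniform hypergraph in which every
pairwise intersection of edges has a size in `I = {s : t ∣ s or s ≥ rt(t-1)}`. -/
structure IsJ {V : Type*} [DecidableEq V] (r t : ℕ) (H : Finset (Finset V)) : Prop where
  /-- every edge has `rt²` vertices -/
  uniform : ∀ e ∈ H, e.card = r * t ^ 2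
  /-- all intersection sizes are permissible -/
  inter : ∀ e ∈ H, ∀ f ∈ H, t ∣ (e ∩ f).card ∨ r * t * (t - 1) ≤ (e ∩ f).card

/-- The degree of a vertex: the number of edges containing it. -/
def hdegree {V : Type*} [DecidableEq V] (H : Finset (Finset V)) (v : V) : ℕ :=
  (H.filter (fun e => v ∈ e)).card

/-- The maximum degree `Δ(H)` over all vertices. -/
def hmaxDegree {V : Type*} [Fintype V] [DecidableEq V] (H : Finset (Finset V)) : ℕ :=
  Finset.univ.sup (hdegree H)

/-- `T` splits the vertex set into `⌊n/t⌋` pairwise disjoint teams of size `t`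
(and the fewer than `t` vertices that are left over). -/
structure IsTeamSystem {V : Type*} [Fintype V] (t : ℕ) (T : Finset (Finset V)) : Prop where
  card_eq : T.card = Fintype.card V / t
  team_card : ∀ A ∈ T, A.card = t
  disjoint : ∀ A ∈ T, ∀ B ∈ T, A ≠ B → Disjoint A B

/-- The thick clique with teams `T`: its edges are the unions of `l` distinct teams. -/
def thickClique {V : Type*} [DecidableEq V] (l : ℕ) (T : Finset (Finset V)) :
    Finset (Finset V) :=
  (T.powersetCard l).image (fun S => S.biUnion id)

end Defs

/-! Write m = rt and k = mt, so edges have k vertices. The method is Füredi's delta-system method.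
Two kernels always meet in the intersection of two edges (`IsKernel.exists_inter_eq`), so kernels
inherit the restriction on intersection sizes.

Structure. By Füredi's lemma (`exists_homogeneous`) any subfamily contains a positive proportion S
in which the pattern of intersections, projected onto an edge e, is an intersection-closed family of
kernels. If some (m-1)-subset of e lies in no proper member of this family, then the vertices of its
colours determine each edge of S, so |S| ≤ n^(m-1). Otherwise `teams_or_core` leaves two shapes: e
is covered by kernels of size t (teams), or e contains a kernel K of size m(t-1) all of whose
one-point extensions in e are kernels (a core). Hence all but O(n^(m-1)) edges have one of these
shapes (`card_le_of_shapeless`).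

Counting. Teams are pairwise disjoint; the sets of vertices extending distinct cores are disjoint
from one another and from all teams. With a teams, u vertices outside them, and w_K vertices
extending the core K, this gives e(H) ≤ C(a,m) + Σ min(C(w_K,m), Δ) + O(n^(m-1)), where Σ w_K ≤ u
and ta + u = n. If Δ < e(H)/(3t), each core is too inefficient for vertices outside teams to pay
their way: a linear loss in u must be absorbed by a constant, so u is bounded (`exists_rest_bound`).

Endgame. If u < t, every edge is a union of teams and e(H) ≤ C(⌊n/t⌋,m). If u is bounded but at
least t, a team is missing, which costs order n^(m-1) edges, while only O(n^(m-2)) edges meet the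
rest (`card_le_of_rest_bounded`, `exists_order_bound`). Both contradict the assumed number of edges.

For a thick clique with N = ⌊n/t⌋ the ratio Δ/e is m/N, which tends to 0; this gives sharpness. -/

/-- `A` is a kernel of `H` (with parameter `k`) if `A` extends to edges of `H` that avoid any
prescribed set of at most `k` further vertices. -/
def IsKernel {V : Type*} [DecidableEq V] (k : ℕ) (H : Finset (Finset V)) (A : Finset V) : Prop :=
  ∀ B : Finset V, B.card ≤ k → ∃ e ∈ H, A ⊆ e ∧ e ∩ B ⊆ A

/-! ### Kernels and their intersections -/

section Kernel

variable {V : Type*} [DecidableEq V]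

theorem IsKernel.mono {k : ℕ} {H H' : Finset (Finset V)} {A : Finset V} (h : IsKernel k H A)
    (hH : H ⊆ H') : IsKernel k H' A := by
  intro B hB
  obtain ⟨e, he, h1, h2⟩ := h B hB
  exact ⟨e, hH he, h1, h2⟩

theorem isKernel_of_mem {k : ℕ} {H : Finset (Finset V)} {e : Finset V} (he : e ∈ H) :
    IsKernel k H e :=
  fun _ _ => ⟨e, he, subset_rfl, Finset.inter_subset_left⟩

theorem IsKernel.card_le {k : ℕ} {H : Finset (Finset V)} {A : Finset V} (h : IsKernel k H A)
    (hu : ∀ e ∈ H, e.card = k) : A.card ≤ k := by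
  obtain ⟨e, he, h1, -⟩ := h ∅ (by simp)
  exact (Finset.card_le_card h1).trans (hu e he).le

/-- Extend `A` to an edge avoiding `B \ A`, then `B` to an edge avoiding the rest of the first edge.
Uniformity keeps both forbidden sets within the budget `k`. -/
theorem IsKernel.exists_inter_eq {k : ℕ} {H : Finset (Finset V)} {A B : Finset V}
    (hu : ∀ e ∈ H, e.card = k) (hA : IsKernel k H A) (hB : IsKernel k H B) :
    ∃ e ∈ H, ∃ f ∈ H, e ∩ f = A ∩ B := by
  obtain ⟨e, he, h1, h2⟩ := hA B (hB.card_le hu)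
  obtain ⟨f, hf, h3, h4⟩ := hB e (hu e he).le
  refine ⟨e, he, f, hf, ?_⟩
  ext x
  simp only [Finset.subset_iff, Finset.mem_inter] at *
  grind

end Kernel

/-! ### Intersection-closed families inside a single edge -/

section Local

variable {α : Type*} [DecidableEq α]

/-- In inclusion-exclusion every term is, up to sign, the size of an intersection of members, which
is again a member. -/
theorem dvd_card_biUnion_of_inter_closed {t : ℕ} (S : Finset (Finset α))
    (hS : ∀ A ∈ S, ∀ B ∈ S, A ∩ B ∈ S) (hd : ∀ A ∈ S, t ∣ A.card) :
    t ∣ (S.biUnion id).card := by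
  have h := Finset.inclusion_exclusion_card_biUnion S (fun A => A)
  have h2 : (t : ℤ) ∣ ((S.biUnion (fun A => A)).card : ℤ) := by
    rw [h]
    refine Finset.dvd_sum fun u _ => Dvd.dvd.mul_left ?_ _
    have hne := (Finset.mem_filter.1 u.2).2
    have hsub := Finset.mem_powerset.1 (Finset.mem_filter.1 u.2).1
    have : u.1.inf' hne (fun A => A) ∈ S := by
      refine Finset.inf'_induction (p := fun A => A ∈ S) hne _ ?_ (fun b hb => hsub hb)
      intro a ha b hb
      exact hS a ha b hb
    exact_mod_cast hd _ this
  exact_mod_cast h2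

theorem exists_closure {E : Finset α} {F : Set (Finset α)} (hE : E ∈ F)
    (hF : ∀ A ∈ F, ∀ B ∈ F, A ∩ B ∈ F) {X : Finset α} (hX : X ⊆ E) :
    ∃ C ∈ F, X ⊆ C ∧ ∀ G ∈ F, X ⊆ G → C ⊆ G := by
  have hex : ∃ n, ∃ C ∈ F, X ⊆ C ∧ C.card = n := ⟨_, E, hE, hX, rfl⟩
  classical
  obtain ⟨C, hC, hXC, hcard⟩ := Nat.find_spec hex
  refine ⟨C, hC, hXC, fun G hG hXG => ?_⟩
  have h1 : Nat.find hex ≤ (C ∩ G).card :=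
    Nat.find_min' hex ⟨C ∩ G, hF C hC G hG, Finset.subset_inter hXC hXG, rfl⟩
  have h2 : C ∩ G = C := Finset.eq_of_subset_of_card_le Finset.inter_subset_left (by omega)
  exact Finset.inter_eq_left.1 h2

/-- If all sizes are divisible by `t`, each generation step gains `t` elements. -/
theorem exists_generating_of_dvd {t : ℕ} {E : Finset α} {F : Set (Finset α)} (hE : E ∈ F)
    (hF : ∀ A ∈ F, ∀ B ∈ F, A ∩ B ∈ F) (hsub : ∀ A ∈ F, A ⊆ E) (hd : ∀ A ∈ F, t ∣ A.card)
    (n : ℕ) : ∀ C ∈ F, E.card ≤ C.card + n →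
      ∃ X ⊆ E, t * X.card + C.card ≤ E.card ∧ ∀ G ∈ F, C ⊆ G → X ⊆ G → G = E := by
  induction n with
  | zero =>
    intro C hC hn
    have : C = E := Finset.eq_of_subset_of_card_le (hsub C hC) (by omega)
    subst this
    exact ⟨∅, by simp, by simp, fun G hG h _ => (hsub G hG).antisymm h⟩
  | succ n ih =>
    intro C hC hn
    by_cases hCE : C = E
    · subst hCE
      exact ⟨∅, by simp, by simp, fun G hG h _ => (hsub G hG).antisymm h⟩
    · obtain ⟨y, hyE, hyC⟩ := Finset.exists_of_ssubset ((hsub C hC).ssubset_of_ne hCE)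
      obtain ⟨D, hD, hCD, hmin⟩ := exists_closure hE hF
        (Finset.insert_subset hyE (hsub C hC) : insert y C ⊆ E)
      have hlt : C.card < D.card := by
        have := Finset.card_le_card hCD
        rw [Finset.card_insert_of_notMem hyC] at this
        omega
      obtain ⟨X, hX, hcard, hgen⟩ := ih D hD (by omega)
      have hge : C.card + t ≤ D.card := by
        obtain ⟨a, ha⟩ := hd C hC
        obtain ⟨b, hb⟩ := hd D hD
        have : a < b := by
          rw [ha, hb] at hlt
          exact lt_of_mul_lt_mul_left hlt (Nat.zero_le _)
        calc C.card + t = t * (a + 1) := by rw [ha]; ring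
          _ ≤ t * b := Nat.mul_le_mul_left _ this
          _ = D.card := hb.symm
      refine ⟨insert y X, Finset.insert_subset hyE hX, ?_, ?_⟩
      · have := Nat.mul_le_mul_left t (Finset.card_insert_le y X)
        rw [mul_add, mul_one] at this
        omega
      · intro G hG hCG hyG
        refine hgen G hG (hmin G hG ?_) ((Finset.subset_insert y X).trans hyG)
        exact Finset.insert_subset (hyG (Finset.mem_insert_self y X)) hCG

/-- The two possible shapes of an intersection-closed family with permissible sizes in which all
small sets are covered: a partition into teams, or all sets above a common core. -/
theorem teams_or_core {t m : ℕ} (ht : 2 ≤ t) (hm : 2 ≤ m) (htm : t ∣ m)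
    {E : Finset α} {F : Set (Finset α)} (hE : E ∈ F) (hcardE : E.card = m * t)
    (hF : ∀ A ∈ F, ∀ B ∈ F, A ∩ B ∈ F) (hsub : ∀ A ∈ F, A ⊆ E)
    (hsize : ∀ A ∈ F, t ∣ A.card ∨ m * (t - 1) ≤ A.card)
    (hcov : ∀ X ⊆ E, X.card = m - 1 → ∃ A ∈ F, X ⊆ A ∧ A ≠ E) :
    (∀ x ∈ E, ∃ A ∈ F, x ∈ A ∧ A.card = t) ∨
    (∃ K ∈ F, K.card = m * (t - 1) ∧ ∀ x ∈ E, x ∉ K → insert x K ∈ F) := by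
  have hmt : m * (t - 1) + m = m * t := by
    obtain ⟨s, rfl⟩ : ∃ s, t = s + 1 := ⟨t - 1, by omega⟩
    simp; ring
  have hmle : m ≤ m * t := Nat.le_mul_of_pos_right _ (by omega)
  -- The covering hypothesis in dual form: a set whose only superset in `F` is `E` has at least `m`
  -- points.
  have hgen : ∀ X ⊆ E, (∀ G ∈ F, X ⊆ G → G = E) → m ≤ X.card := by
    intro X hX h
    by_contra hlt
    obtain ⟨Y, hXY, hYE, hY⟩ := Finset.exists_subsuperset_card_eq hX
      (show X.card ≤ m - 1 by omega) (show m - 1 ≤ E.card by omega)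
    obtain ⟨A, hA, hYA, hne⟩ := hcov Y hYE hY
    exact hne (h A hA (hXY.trans hYA))
  by_cases hall : ∀ A ∈ F, t ∣ A.card
  · left
    intro x hx
    obtain ⟨C, hC, hxC, hmin⟩ := exists_closure hE hF (Finset.singleton_subset_iff.2 hx)
    refine ⟨C, hC, Finset.singleton_subset_iff.1 hxC, ?_⟩
    -- Let `C` be the closure of `x`. Each further generator gains `t` points, so `E` is generated
    -- by `x` and at most `(m * t - |C|) / t` others. Since `m` generators are needed, `|C| ≤ t`.
    obtain ⟨X, hX, hcard, hg⟩ := exists_generating_of_dvd hE hF hsub hall E.card C hC (by omega)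
    have h1 := hgen (insert x X) (Finset.insert_subset hx hX) (fun G hG hG' => by
      refine hg G hG (hmin G hG ?_) ((Finset.subset_insert _ _).trans hG')
      exact Finset.singleton_subset_iff.2 (hG' (Finset.mem_insert_self _ _)))
    have h2 := Finset.card_insert_le x X
    have h3 : t * (m - 1) ≤ t * X.card := Nat.mul_le_mul_left _ (by omega)
    have h4 : t * (m - 1) + t = m * t := by
      obtain ⟨s, rfl⟩ : ∃ s, m = s + 1 := ⟨m - 1, by omega⟩
      simp; ring
    have h5 : 0 < C.card := Finset.card_pos.2 ⟨x, Finset.singleton_subset_iff.1 hxC⟩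
    have h6 := Nat.le_of_dvd h5 (hall C hC)
    omega
  · right
    push Not at hall
    have hex : ∃ n, ∃ A ∈ F, ¬ t ∣ A.card ∧ A.card = n := by
      obtain ⟨A, hA, h⟩ := hall
      exact ⟨_, A, hA, h, rfl⟩
    classical
    obtain ⟨P, hP, hPt, hPn⟩ := Nat.find_spec hex
    have hPmin : ∀ A ∈ F, A ⊆ P → A ≠ P → t ∣ A.card := by
      intro A hA hAP hne
      by_contra hnd
      have := Nat.find_min' hex ⟨A, hA, hnd, rfl⟩
      exact hne (Finset.eq_of_subset_of_card_le hAP (by omega))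
    -- `P` is a smallest member of size not divisible by `t`. If no single point generated it, it
    -- would be the union of its proper submembers, an intersection-closed family of sizes divisible
    -- by `t`.
    have hy : ∃ y ∈ P, ∀ G ∈ F, y ∈ G → P ⊆ G := by
      by_contra hno
      push Not at hno
      apply hPt
      have hS : P = (P.powerset.filter (fun A => A ∈ F ∧ A ≠ P)).biUnion id := by
        ext x
        simp only [Finset.mem_biUnion, Finset.mem_filter, Finset.mem_powerset, id]
        constructor
        · intro hx
          obtain ⟨G, hG, hxG, hPG⟩ := hno x hx
          refine ⟨P ∩ G, ⟨Finset.inter_subset_left, hF P hP G hG, ?_⟩,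
            Finset.mem_inter.2 ⟨hx, hxG⟩⟩
          intro h
          exact hPG (Finset.inter_eq_left.1 h)
        · rintro ⟨A, ⟨hAP, -⟩, hxA⟩
          exact hAP hxA
      rw [hS]
      apply dvd_card_biUnion_of_inter_closed
      · intro A hA B hB
        simp only [Finset.mem_filter, Finset.mem_powerset] at hA hB ⊢
        refine ⟨Finset.inter_subset_left.trans hA.1, hF A hA.2.1 B hB.2.1, ?_⟩
        intro h
        exact hA.2.2 (hA.1.antisymm (h ▸ Finset.inter_subset_left))
      · intro A hA
        simp only [Finset.mem_filter, Finset.mem_powerset] at hA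
        exact hPmin A hA.2.1 hA.1 hA.2.2
    obtain ⟨y, hyP, hyG⟩ := hy
    have hPE := hsub P hP
    have hyE := hPE hyP
    have hcs : (E \ P).card + P.card = m * t := by
      rw [Finset.card_sdiff_add_card_eq_card hPE, hcardE]
    have hdm : t ∣ m * (t - 1) := htm.mul_right _
    have hPlow : m * (t - 1) < P.card := by
      rcases hsize P hP with h | h
      · exact absurd h hPt
      · refine lt_of_le_of_ne h fun h' => hPt (h' ▸ hdm)
    have hyM : y ∉ E \ P := by simp [hyP]
    -- The point `y` forces `P`, so `y` together with `E \ P` generates `E`. With `|P| > m * (t -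
    -- 1)` this pins down `|P| = m * (t - 1) + 1`.
    have hgy := hgen (insert y (E \ P)) (Finset.insert_subset hyE Finset.sdiff_subset)
      (fun G hG h => by
        refine (hsub G hG).antisymm fun x hx => ?_
        by_cases hxP : x ∈ P
        · exact hyG G hG (h (Finset.mem_insert_self _ _)) hxP
        · exact h (Finset.mem_insert_of_mem (Finset.mem_sdiff.2 ⟨hx, hxP⟩)))
    rw [Finset.card_insert_of_notMem hyM] at hgy
    have hM : (E \ P).card = m - 1 := by omega
    have hPc : P.card = m * (t - 1) + 1 := by omega
    -- If the closure of `{y, z}` contained another `w` outside `P`, then `w` could be dropped from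
    -- the `m` generators above.
    have hPz : ∀ z ∈ E \ P, insert z P ∈ F := by
      intro z hz
      obtain ⟨C, hC, hzC, hmin⟩ := exists_closure hE hF
        (Finset.insert_subset hyE (Finset.singleton_subset_iff.2 (Finset.mem_sdiff.1 hz).1) :
          {y, z} ⊆ E)
      have hyC : y ∈ C := hzC (by simp)
      have hzC' : z ∈ C := hzC (by simp)
      have hPC : P ⊆ C := hyG C hC hyC
      have : C = insert z P := by
        refine Finset.Subset.antisymm (fun w hw => ?_) (Finset.insert_subset hzC' hPC)
        by_contra hwn
        rw [Finset.mem_insert, not_or] at hwn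
        have hwM : w ∈ E \ P := Finset.mem_sdiff.2 ⟨hsub C hC hw, hwn.2⟩
        have := hgen (insert y ((E \ P).erase w))
          (Finset.insert_subset hyE ((Finset.erase_subset _ _).trans Finset.sdiff_subset))
          (fun G hG h => by
            have hyG' : y ∈ G := h (Finset.mem_insert_self _ _)
            have hzG : z ∈ G := h (Finset.mem_insert_of_mem
              (Finset.mem_erase.2 ⟨fun h => hwn.1 h.symm, hz⟩))
            refine (hsub G hG).antisymm fun x hx => ?_
            by_cases hxP : x ∈ P
            · exact hyG G hG hyG' hxP
            · by_cases hxw : x = w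
              · subst hxw
                exact hmin G hG (by simp [Finset.insert_subset_iff, hyG', hzG]) hw
              · exact h (Finset.mem_insert_of_mem
                  (Finset.mem_erase.2 ⟨hxw, Finset.mem_sdiff.2 ⟨hx, hxP⟩⟩)))
        have h2 := Finset.card_insert_le y ((E \ P).erase w)
        rw [Finset.card_erase_of_mem hwM] at h2
        omega
      exact this ▸ hC
    -- A proper member containing `E \ P` misses `y`. Its trace on `P` will be `P` minus one point,
    -- and this is the core.
    obtain ⟨C, hC, hMC, hCE⟩ := hcov (E \ P) Finset.sdiff_subset hM
    have hPC : ¬ P ⊆ C := by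
      intro h
      refine hCE ((hsub C hC).antisymm fun x hx => ?_)
      by_cases hxP : x ∈ P
      · exact h hxP
      · exact hMC (Finset.mem_sdiff.2 ⟨hx, hxP⟩)
    have hyC : y ∉ C := fun h => hPC (hyG C hC h)
    have hCP : C ∩ P ∈ F := hF C hC P hP
    have hCPne : C ∩ P ≠ P := fun h => hPC (Finset.inter_eq_right.1 h)
    have hdCP := hPmin _ hCP Finset.inter_subset_right hCPne
    have hCPlt := Finset.card_lt_card (Finset.inter_subset_right.ssubset_of_ne hCPne)
    have hCz : ∀ z ∈ E \ P, insert z (C ∩ P) ∈ F := by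
      intro z hz
      have : insert z (C ∩ P) = C ∩ insert z P := by
        rw [Finset.inter_insert_of_mem (hMC hz)]
      rw [this]
      exact hF _ hC _ (hPz z hz)
    obtain ⟨z, hz⟩ : (E \ P).Nonempty := Finset.card_pos.1 (by omega)
    have hzn : z ∉ C ∩ P := fun h =>
      (Finset.mem_sdiff.1 hz).2 (Finset.mem_inter.1 h).2
    -- Adding `z` to `C ∩ P` destroys divisibility by `t`, so the enlarged size is at least `m * (t
    -- - 1)`. Equality there is excluded because `t` divides `m * (t - 1)`.
    have hge : m * (t - 1) ≤ (C ∩ P).card := by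
      have h1 := hsize _ (hCz z hz)
      rw [Finset.card_insert_of_notMem hzn] at h1
      have h2 : m * (t - 1) ≤ (C ∩ P).card + 1 := by
        rcases h1 with h1 | h1
        · have := (Nat.dvd_add_right hdCP).1 h1
          have := Nat.le_of_dvd one_pos this
          omega
        · exact h1
      by_contra hlt
      have h3 : m * (t - 1) = (C ∩ P).card + 1 := by omega
      rw [h3] at hdm
      have := Nat.le_of_dvd one_pos ((Nat.dvd_add_right hdCP).1 hdm)
      omega
    refine ⟨C ∩ P, hCP, by omega, fun x hx hxn => ?_⟩
    by_cases hxP : x ∈ P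
    · have hins : ∀ w ∈ P, w ∉ C ∩ P → insert w (C ∩ P) = P := by
        intro w hw hwn
        refine Finset.eq_of_subset_of_card_le
          (Finset.insert_subset hw Finset.inter_subset_right) ?_
        rw [Finset.card_insert_of_notMem hwn]
        omega
      rw [hins x hxP hxn]
      exact hP
    · exact hCz x (Finset.mem_sdiff.2 ⟨hx, hxP⟩)

end Local

/-! ### Füredi's intersection semilattice lemma -/

section Furedi

variable {V : Type*} [DecidableEq V]

/-- The part of `e` with colours in `J`. -/
def colourPart {k : ℕ} (χ : V → Fin k) (e : Finset V) (J : Finset (Fin k)) : Finset V :=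
  e.filter (fun v => χ v ∈ J)

/-- Deleting the classes of edges whose `J`-part is not a kernel, for `J ∈ 𝓙`. -/
theorem exists_kernel_cleanup {k : ℕ} (χ : V → Fin k) (𝓙 : Finset (Finset (Fin k)))
    (n : ℕ) : ∀ H : Finset (Finset V), H.card ≤ n →
    ∃ H' ⊆ H, ∃ D : Finset (Fin k) → Finset (Finset V),
      (∀ J ∈ 𝓙, ∀ e ∈ H', IsKernel k H' (colourPart χ e J)) ∧
      (∀ J, D J ⊆ H) ∧
      (∀ J, ∀ e ∈ D J, ¬ IsKernel k
        ((D J).filter (fun f => colourPart χ f J = colourPart χ e J)) (colourPart χ e J)) ∧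
      H ⊆ H' ∪ 𝓙.biUnion D := by
  induction n with
  | zero =>
    intro H hH
    have : H = ∅ := Finset.card_eq_zero.1 (by omega)
    subst this
    exact ⟨∅, subset_rfl, fun _ => ∅, by simp, by simp, by simp, by simp⟩
  | succ n ih =>
    intro H hH
    by_cases hall : ∀ J ∈ 𝓙, ∀ e ∈ H, IsKernel k H (colourPart χ e J)
    · exact ⟨H, subset_rfl, fun _ => ∅, hall, by simp, by simp, by simp⟩
    push Not at hall
    obtain ⟨J, hJ, e, he, hker⟩ := hall
    set R := H.filter (fun f => colourPart χ f J = colourPart χ e J) with hR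
    have heR : e ∈ R := Finset.mem_filter.2 ⟨he, rfl⟩
    have hlt : (H \ R).card < H.card :=
      Finset.card_lt_card ((Finset.ssubset_iff_of_subset Finset.sdiff_subset).2
        ⟨e, he, by simp [heR]⟩)
    obtain ⟨H', hH', D, h1, h2, h3, h4⟩ := ih (H \ R) (by omega)
    refine ⟨H', hH'.trans Finset.sdiff_subset,
      -- A whole class `R` of edges sharing a `J`-part is deleted at once, so `R` never shares a
      -- class with the later deletions in `D J`.
      fun I => if I = J then D J ∪ R else D I, h1, ?_, ?_, ?_⟩
    · intro I
      by_cases hI : I = J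
      · simp only [hI, if_true]
        exact Finset.union_subset ((h2 J).trans Finset.sdiff_subset) (Finset.filter_subset _ _)
      · simp only [hI, if_false]
        exact (h2 I).trans Finset.sdiff_subset
    · intro I f hf
      by_cases hI : I = J
      · subst hI
        simp only [if_true] at hf ⊢
        by_cases hfR : f ∈ R
        · have hfe : colourPart χ f I = colourPart χ e I := (Finset.mem_filter.1 hfR).2
          rw [hfe]
          intro hk
          refine hker (hk.mono fun g hg => ?_)
          rcases Finset.mem_union.1 (Finset.mem_filter.1 hg).1 with hg | hg
          · exact (Finset.mem_sdiff.1 (h2 I hg)).1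
          · exact (Finset.mem_filter.1 hg).1
        · have hfD : f ∈ D I := by
            rcases Finset.mem_union.1 hf with h | h
            · exact h
            · exact absurd h hfR
          intro hk
          refine h3 I f hfD (hk.mono fun g hg => ?_)
          obtain ⟨hg1, hg2⟩ := Finset.mem_filter.1 hg
          refine Finset.mem_filter.2 ⟨?_, hg2⟩
          rcases Finset.mem_union.1 hg1 with h | h
          · exact h
          · exfalso
            apply hfR
            refine Finset.mem_filter.2 ⟨(Finset.mem_sdiff.1 (h2 I hfD)).1, ?_⟩
            rw [← hg2]
            exact (Finset.mem_filter.1 h).2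
      · simp only [hI, if_false] at hf ⊢
        exact h3 I f hf
    · intro f hf
      by_cases hfR : f ∈ R
      · refine Finset.mem_union_right _ (Finset.mem_biUnion.2 ⟨J, hJ, ?_⟩)
        simp [hfR]
      · rcases Finset.mem_union.1 (h4 (Finset.mem_sdiff.2 ⟨hf, hfR⟩)) with h | h
        · exact Finset.mem_union_left _ h
        · obtain ⟨I, hI, hfI⟩ := Finset.mem_biUnion.1 h
          refine Finset.mem_union_right _ (Finset.mem_biUnion.2 ⟨I, hI, ?_⟩)
          by_cases hIJ : I = J
          · subst hIJ; simp [hfI]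
          · simp [hIJ, hfI]

/-- A family in which no `J`-part is a kernel has a large subfamily in which `J` is never the
colour set of an intersection. -/
theorem exists_avoiding_colour_set {k : ℕ} (χ : V → Fin k) (J : Finset (Fin k))
    (D : Finset (Finset V)) (hrb : ∀ e ∈ D, Set.InjOn χ e)
    (hD : ∀ e ∈ D, ¬ IsKernel k
        (D.filter (fun f => colourPart χ f J = colourPart χ e J)) (colourPart χ e J)) :
    ∃ D' ⊆ D, D.card ≤ k * D'.card ∧ ∀ e ∈ D', ∀ f ∈ D', (e ∩ f).image χ ≠ J := by
  classical
  have hcl : ∀ A ∈ D.image (fun f => colourPart χ f J), ∃ b, b ∉ A ∧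
      (D.filter (fun f => colourPart χ f J = A)).card ≤
        k * (D.filter (fun f => colourPart χ f J = A ∧ b ∈ f)).card := by
    intro A hA
    obtain ⟨e, he, rfl⟩ := Finset.mem_image.1 hA
    have hn := hD e he
    unfold IsKernel at hn
    push Not at hn
    obtain ⟨B, hB, hn⟩ := hn
    set A := colourPart χ e J
    set Q := D.filter (fun f => colourPart χ f J = A)
    have hcov : Q ⊆ (B \ A).biUnion (fun b => D.filter (fun f => colourPart χ f J = A ∧ b ∈ f)) := by
      intro f hf
      obtain ⟨hf1, hf2⟩ := Finset.mem_filter.1 hf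
      have hAf : A ⊆ f := by rw [← hf2]; exact Finset.filter_subset _ _
      obtain ⟨b, hb, hbA⟩ := Finset.not_subset.1 (hn f hf hAf)
      obtain ⟨hbf, hbB⟩ := Finset.mem_inter.1 hb
      exact Finset.mem_biUnion.2 ⟨b, Finset.mem_sdiff.2 ⟨hbB, hbA⟩,
        Finset.mem_filter.2 ⟨hf1, hf2, hbf⟩⟩
    have hne : (B \ A).Nonempty := by
      have : e ∈ Q := Finset.mem_filter.2 ⟨he, rfl⟩
      obtain ⟨b, hb, -⟩ := Finset.mem_biUnion.1 (hcov this)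
      exact ⟨b, hb⟩
    obtain ⟨b, hb, hmax⟩ := Finset.exists_max_image (B \ A)
      (fun b => (D.filter (fun f => colourPart χ f J = A ∧ b ∈ f)).card) hne
    refine ⟨b, (Finset.mem_sdiff.1 hb).2, ?_⟩
    calc Q.card ≤ _ := Finset.card_le_card hcov
      _ ≤ ∑ c ∈ B \ A, (D.filter (fun f => colourPart χ f J = A ∧ c ∈ f)).card :=
        Finset.card_biUnion_le
      _ ≤ (B \ A).card • _ := Finset.sum_le_card_nsmul _ _ _ hmax
      _ ≤ k * _ := by
        rw [smul_eq_mul]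
        exact Nat.mul_le_mul_right _ ((Finset.card_le_card Finset.sdiff_subset).trans hB)
  rcases D.eq_empty_or_nonempty with rfl | ⟨e₀, he₀⟩
  · exact ⟨∅, subset_rfl, by simp, by simp⟩
  have : Nonempty V := ⟨(hcl _ (Finset.mem_image_of_mem _ he₀)).choose⟩
  choose! b hbA hb using hcl
  -- Keep the edges containing the popular vertex `b A` of their class `A`. If `e ∩ f` had colour
  -- set `J`, rainbowness would make it the common `J`-part of both edges, yet both also contain `b
  -- (e ∩ f)`, which lies outside it.
  refine ⟨D.filter (fun f => b (colourPart χ f J) ∈ f), Finset.filter_subset _ _, ?_, ?_⟩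
  · rw [Finset.card_eq_sum_card_image (fun f => colourPart χ f J) D,
      Finset.card_eq_sum_card_fiberwise (s := D.filter (fun f => b (colourPart χ f J) ∈ f))
        (t := D.image (fun f => colourPart χ f J)) (f := fun f => colourPart χ f J),
      Finset.mul_sum]
    · refine Finset.sum_le_sum fun A hA => (hb A hA).trans (Nat.mul_le_mul_left _ ?_)
      refine Finset.card_le_card fun f hf => ?_
      simp only [Finset.mem_filter] at hf ⊢
      exact ⟨⟨hf.1, hf.2.1 ▸ hf.2.2⟩, hf.2.1⟩
    · intro f hf
      exact Finset.mem_image_of_mem _ (Finset.mem_filter.1 hf).1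
  · intro e he f hf h
    obtain ⟨he, hbe⟩ := Finset.mem_filter.1 he
    obtain ⟨hf, hbf⟩ := Finset.mem_filter.1 hf
    have key : ∀ g ∈ D, e ∩ f ⊆ g → colourPart χ g J = e ∩ f := by
      intro g hg hsub
      ext x
      constructor
      · intro hx
        obtain ⟨hxg, hxJ⟩ := Finset.mem_filter.1 hx
        rw [← h] at hxJ
        obtain ⟨y, hy, hyx⟩ := Finset.mem_image.1 hxJ
        rw [← hrb g hg (hsub hy) hxg hyx]
        exact hy
      · intro hx
        exact Finset.mem_filter.2 ⟨hsub hx, h ▸ Finset.mem_image_of_mem _ hx⟩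
    have h1 := key e he Finset.inter_subset_left
    have h2 := key f hf Finset.inter_subset_right
    rw [h1] at hbe
    rw [h2] at hbf
    refine hbA (e ∩ f) ?_ (Finset.mem_inter.2 ⟨hbe, hbf⟩)
    rw [← h1]
    exact Finset.mem_image_of_mem (fun f => colourPart χ f J) he

/-- The induction behind Füredi's intersection semilattice lemma. -/
theorem exists_homogeneous_of_rainbow {k : ℕ} (hk : 1 ≤ k) (χ : V → Fin k) (n : ℕ) :
    ∀ (𝓙 : Finset (Finset (Fin k))) (H : Finset (Finset V)), 𝓙.card = n →
      (∀ e ∈ H, Set.InjOn χ e) →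
      (∀ e ∈ H, ∀ f ∈ H, (e ∩ f).image χ ∈ 𝓙) →
      ∃ H' ⊆ H, H.card ≤ (k * (2 ^ k + 1)) ^ n * H'.card ∧
        ∀ e ∈ H', ∀ f ∈ H', ∀ g ∈ H', IsKernel k H' (colourPart χ g ((e ∩ f).image χ)) := by
  have hc : 1 ≤ k * (2 ^ k + 1) := Nat.mul_pos hk (by positivity)
  induction n with
  | zero =>
    intro 𝓙 H h𝓙 _ hJ
    rw [Finset.card_eq_zero] at h𝓙
    subst h𝓙
    have hH : H = ∅ := by
      by_contra hne
      obtain ⟨e, he⟩ := Finset.nonempty_iff_ne_empty.2 hne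
      exact absurd (hJ e he e he) (Finset.notMem_empty _)
    subst hH
    exact ⟨∅, subset_rfl, by simp, by simp⟩
  | succ n ih =>
    intro 𝓙 H h𝓙 hrb hJ
    obtain ⟨H', hH', D, h1, h2, h3, h4⟩ := exists_kernel_cleanup χ 𝓙 H.card H le_rfl
    -- `H` is covered by `H'` and at most `2 ^ k` deleted families, so one of these has a share of
    -- at least `1 / (2 ^ k + 1)`. If it is `D J`, a factor `k` buys the removal of `J` from the
    -- possible intersection colour sets.
    by_cases hbig : H.card ≤ (2 ^ k + 1) * H'.card
    · refine ⟨H', hH', hbig.trans (Nat.mul_le_mul_right _ ?_), fun e he f hf g hg =>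
        h1 _ (hJ e (hH' he) f (hH' hf)) g hg⟩
      calc 2 ^ k + 1 ≤ k * (2 ^ k + 1) := Nat.le_mul_of_pos_left _ hk
        _ ≤ _ := Nat.le_self_pow (by omega) _
    · have hex : ∃ J ∈ 𝓙, H.card ≤ (2 ^ k + 1) * (D J).card := by
        by_contra hno
        push Not at hno hbig
        have hcard : H.card ≤ H'.card + ∑ J ∈ 𝓙, (D J).card :=
          (Finset.card_le_card h4).trans ((Finset.card_union_le _ _).trans
            (Nat.add_le_add_left Finset.card_biUnion_le _))
        have hJc : 𝓙.card ≤ 2 ^ k := by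
          have := Finset.card_le_univ 𝓙
          rwa [Fintype.card_finset, Fintype.card_fin] at this
        have hsum : ∑ J ∈ 𝓙, (2 ^ k + 1) * (D J).card ≤ 2 ^ k * H.card :=
          (Finset.sum_le_card_nsmul _ _ _ fun J hJ => (hno J hJ).le).trans
            (by rw [smul_eq_mul]; exact Nat.mul_le_mul_right _ hJc)
        rw [← Finset.mul_sum] at hsum
        have := Nat.mul_le_mul_left (2 ^ k + 1) hcard
        rw [mul_add] at this
        linarith
      obtain ⟨J, hJ𝓙, hDJ⟩ := hex
      obtain ⟨D', hD', hcard, hav⟩ := exists_avoiding_colour_set χ J (D J)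
        (fun e he => hrb e (h2 J he)) (h3 J)
      obtain ⟨H'', hH'', hcard', hker⟩ := ih (𝓙.erase J) D'
        (by rw [Finset.card_erase_of_mem hJ𝓙]; omega)
        (fun e he => hrb e (h2 J (hD' he)))
        (fun e he f hf => Finset.mem_erase.2 ⟨hav e he f hf,
          hJ e (h2 J (hD' he)) f (h2 J (hD' hf))⟩)
      refine ⟨H'', hH''.trans (hD'.trans (h2 J)), ?_, hker⟩
      calc H.card ≤ (2 ^ k + 1) * (D J).card := hDJ
        _ ≤ (2 ^ k + 1) * (k * D'.card) := Nat.mul_le_mul_left _ hcard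
        _ ≤ (2 ^ k + 1) * (k * ((k * (2 ^ k + 1)) ^ n * H''.card)) := by gcongr
        _ = (k * (2 ^ k + 1)) ^ (n + 1) * H''.card := by ring

/-- Averaging over all colourings: prescribing one bijection on an edge already shows that at least
a fraction `k ^ (-k)` of the colourings is injective on it. -/
theorem exists_rainbow [Fintype V] {k : ℕ} (hk : 1 ≤ k) (H : Finset (Finset V))
    (hu : ∀ e ∈ H, e.card = k) :
    ∃ χ : V → Fin k, ∃ H' ⊆ H, (∀ e ∈ H', Set.InjOn χ e) ∧ H.card ≤ k ^ k * H'.card := by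
  classical
  have hcount : ∀ e ∈ H, k ^ (Fintype.card V) ≤
      k ^ k * (Finset.univ.filter (fun χ : V → Fin k => Set.InjOn χ e)).card := by
    intro e he
    have hek := hu e he
    obtain ⟨g⟩ : Nonempty (e ≃ Fin k) := ⟨Fintype.equivFinOfCardEq (by simp [hek])⟩
    have hkV : k ≤ Fintype.card V := hek ▸ Finset.card_le_univ e
    let P : Finset (V → Fin k) :=
      Fintype.piFinset (fun v => if h : v ∈ e then {g ⟨v, h⟩} else Finset.univ)
    have hP : P ⊆ Finset.univ.filter (fun χ : V → Fin k => Set.InjOn χ e) := by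
      intro χ hχ
      refine Finset.mem_filter.2 ⟨Finset.mem_univ _, ?_⟩
      have hval : ∀ v (h : v ∈ e), χ v = g ⟨v, h⟩ := by
        intro v h
        have := Fintype.mem_piFinset.1 hχ v
        simpa [h] using this
      intro x hx y hy hxy
      rw [hval x hx, hval y hy] at hxy
      simpa using g.injective hxy
    have hPc : P.card = k ^ (Fintype.card V - k) := by
      rw [Fintype.card_piFinset]
      have : ∀ v, (if h : v ∈ e then ({g ⟨v, h⟩} : Finset (Fin k)) else Finset.univ).card =
          if v ∈ e then 1 else k := by
        intro v
        by_cases h : v ∈ e <;> simp [h]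
      simp only [this]
      rw [Finset.prod_ite]
      simp only [Finset.prod_const_one, one_mul, Finset.prod_const]
      congr 1
      rw [Finset.filter_not, Finset.filter_mem_eq_inter, Finset.univ_inter,
        Finset.card_sdiff_of_subset (Finset.subset_univ _), hek, Finset.card_univ]
    calc k ^ (Fintype.card V) = k ^ k * k ^ (Fintype.card V - k) := by
          rw [← pow_add]; congr 1; omega
      _ = k ^ k * P.card := by rw [hPc]
      _ ≤ _ := Nat.mul_le_mul_left _ (Finset.card_le_card hP)
  have : Nonempty (Fin k) := ⟨⟨0, hk⟩⟩
  obtain ⟨χ, -, hχ⟩ : ∃ χ ∈ (Finset.univ : Finset (V → Fin k)),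
      H.card ≤ k ^ k * (H.filter (fun e : Finset V => Set.InjOn χ e)).card := by
    by_contra hno
    push Not at hno
    have h1 := Finset.sum_lt_sum_of_nonempty (Finset.univ_nonempty) hno
    rw [← Finset.mul_sum] at h1
    have h2 : ∑ χ : V → Fin k, (H.filter (fun e : Finset V => Set.InjOn χ e)).card =
        ∑ e ∈ H, (Finset.univ.filter (fun χ : V → Fin k => Set.InjOn χ e)).card := by
      simp only [Finset.card_filter]
      exact Finset.sum_comm
    rw [h2, Finset.mul_sum] at h1
    have h3 := Finset.sum_le_sum hcount
    have h4 := h3.trans_lt h1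
    simp only [Finset.sum_const, smul_eq_mul, Finset.card_univ, Fintype.card_pi,
      Finset.prod_const, Fintype.card_fin] at h4
    rw [mul_comm] at h4
    exact lt_irrefl _ h4
  exact ⟨χ, _, Finset.filter_subset _ _, fun e he => (Finset.mem_filter.1 he).2, hχ⟩

/-- The constant in Füredi's intersection semilattice lemma. -/
def furediConst (k : ℕ) : ℕ := k ^ k * (k * (2 ^ k + 1)) ^ (2 ^ k)

/-- Füredi's intersection semilattice lemma, in terms of kernels. -/
theorem exists_homogeneous [Fintype V] {k : ℕ} (hk : 1 ≤ k) (H : Finset (Finset V))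
    (hu : ∀ e ∈ H, e.card = k) :
    ∃ χ : V → Fin k, ∃ H' ⊆ H, H.card ≤ furediConst k * H'.card ∧
      (∀ e ∈ H', Set.InjOn χ e) ∧
      ∀ e ∈ H', ∀ f ∈ H', ∀ g ∈ H', IsKernel k H' (colourPart χ g ((e ∩ f).image χ)) := by
  obtain ⟨χ, H₁, hH₁, hrb, hc⟩ := exists_rainbow hk H hu
  obtain ⟨H', hH', hc', hker⟩ := exists_homogeneous_of_rainbow hk χ (2 ^ k)
    Finset.univ H₁ (by simp) hrb (by simp)
  refine ⟨χ, H', hH'.trans hH₁, ?_, fun e he => hrb e (hH' he), hker⟩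
  calc H.card ≤ k ^ k * H₁.card := hc
    _ ≤ k ^ k * ((k * (2 ^ k + 1)) ^ (2 ^ k) * H'.card) := Nat.mul_le_mul_left _ hc'
    _ = _ := by rw [furediConst]; ring

end Furedi

/-! ### Team edges, core edges and the remaining edges -/

section Shapes

variable {V : Type*} [DecidableEq V]

/-- `e` is covered by kernels of size `t` lying inside it. -/
def IsTeamEdge (k t : ℕ) (H : Finset (Finset V)) (e : Finset V) : Prop :=
  ∀ x ∈ e, ∃ A ⊆ e, x ∈ A ∧ A.card = t ∧ IsKernel k H A

/-- All one-element extensions of the core `K` inside `e` are kernels. -/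
def IsCoreOf (k s : ℕ) (H : Finset (Finset V)) (K e : Finset V) : Prop :=
  K ⊆ e ∧ K.card = s ∧ IsKernel k H K ∧ ∀ x ∈ e, x ∉ K → IsKernel k H (insert x K)

/-- In a homogeneous subfamily, an edge whose `(m - 1)`-sets are all covered has one of the two
shapes. So some `(m - 1)`-set is uncovered, and its colours encode the edges of the subfamily
injectively. -/
theorem card_le_of_shapeless [Fintype V] {m t : ℕ} (ht : 2 ≤ t) (hm : 2 ≤ m) (htm : t ∣ m)
    {H B : Finset (Finset V)} (hu : ∀ e ∈ H, e.card = m * t)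
    (hL : ∀ e ∈ H, ∀ f ∈ H, t ∣ (e ∩ f).card ∨ m * (t - 1) ≤ (e ∩ f).card)
    (hBH : B ⊆ H) (hB1 : ∀ e ∈ B, ¬ IsTeamEdge (m * t) t H e)
    (hB2 : ∀ e ∈ B, ∀ K, ¬ IsCoreOf (m * t) (m * (t - 1)) H K e) :
    B.card ≤ furediConst (m * t) * Fintype.card V ^ (m - 1) := by
  obtain ⟨χ, S, hSB, hcard, hrb, hker⟩ := exists_homogeneous (k := m * t)
    (Nat.mul_pos (by omega) (by omega)) B (fun e he => hu e (hBH he))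
  refine hcard.trans (Nat.mul_le_mul_left _ ?_)
  have hSu : ∀ e ∈ S, e.card = m * t := fun e he => hu e (hBH (hSB he))
  rcases S.eq_empty_or_nonempty with rfl | ⟨e, he⟩
  · simp
  -- All intersections of edges of `S`, transported to `e` along the colours. By homogeneity they
  -- are kernels, and this makes the family intersection-closed.
  set F : Set (Finset V) :=
    {A | ∃ f ∈ S, ∃ g ∈ S, A = colourPart χ e ((f ∩ g).image χ)} with hFdef
  have hpart : ∀ X ⊆ e, colourPart χ e (X.image χ) = X := by
    intro X hX
    ext x
    constructor
    · intro hx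
      obtain ⟨hxe, hxJ⟩ := Finset.mem_filter.1 hx
      obtain ⟨y, hy, hyx⟩ := Finset.mem_image.1 hxJ
      rw [← hrb e he (hX hy) hxe hyx]
      exact hy
    · intro hx
      exact Finset.mem_filter.2 ⟨hX hx, Finset.mem_image_of_mem _ hx⟩
  have hFsub : ∀ A ∈ F, A ⊆ e := by
    rintro A ⟨f, hf, g, hg, rfl⟩
    exact Finset.filter_subset _ _
  have hFker : ∀ A ∈ F, IsKernel (m * t) S A := by
    rintro A ⟨f, hf, g, hg, rfl⟩
    exact hker f hf g hg e he
  have hFmem : ∀ A ⊆ e, ∀ f ∈ S, ∀ g ∈ S, f ∩ g = A → A ∈ F := by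
    intro A hA f hf g hg hfg
    refine ⟨f, hf, g, hg, ?_⟩
    rw [hfg, hpart A hA]
  have hFe : e ∈ F := hFmem e subset_rfl e he e he (Finset.inter_self e)
  have hFinter : ∀ A ∈ F, ∀ A' ∈ F, A ∩ A' ∈ F := by
    intro A hA A' hA'
    obtain ⟨f, hf, g, hg, hfg⟩ := (hFker A hA).exists_inter_eq hSu (hFker A' hA')
    exact hFmem _ (Finset.inter_subset_left.trans (hFsub A hA)) f hf g hg hfg
  have hFsize : ∀ A ∈ F, t ∣ A.card ∨ m * (t - 1) ≤ A.card := by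
    intro A hA
    obtain ⟨f, hf, g, hg, hfg⟩ := (hFker A hA).exists_inter_eq hSu (hFker A hA)
    rw [Finset.inter_self] at hfg
    rw [← hfg]
    exact hL f (hBH (hSB hf)) g (hBH (hSB hg))
  have hSH : S ⊆ H := hSB.trans hBH
  by_cases hcov : ∀ X ⊆ e, X.card = m - 1 → ∃ A ∈ F, X ⊆ A ∧ A ≠ e
  · exfalso
    rcases teams_or_core ht hm htm hFe (hSu e he) hFinter hFsub hFsize hcov with h | h
    · refine hB1 e (hSB he) fun x hx => ?_
      obtain ⟨A, hA, hxA, hAt⟩ := h x hx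
      exact ⟨A, hFsub A hA, hxA, hAt, (hFker A hA).mono hSH⟩
    · obtain ⟨K, hK, hKc, h⟩ := h
      exact hB2 e (hSB he) K ⟨hFsub K hK, hKc, (hFker K hK).mono hSH,
        fun x hx hxK => (hFker _ (h x hx hxK)).mono hSH⟩
  · push Not at hcov
    obtain ⟨X, hX, hXc, hown⟩ := hcov
    have hinjX : Set.InjOn χ X := (hrb e he).mono hX
    have hbij : ∀ f ∈ S, f.image χ = Finset.univ := by
      intro f hf
      apply Finset.eq_univ_of_card
      rw [Finset.card_image_of_injOn (hrb f hf), hSu f hf, Fintype.card_fin]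
    have hpartim : ∀ f ∈ S, (colourPart χ f (X.image χ)).image χ = X.image χ := by
      intro f hf
      ext c
      simp only [Finset.mem_image, colourPart, Finset.mem_filter]
      constructor
      · rintro ⟨x, ⟨-, h⟩, rfl⟩
        exact h
      · rintro h
        have : c ∈ f.image χ := by rw [hbij f hf]; exact Finset.mem_univ _
        obtain ⟨y, hy, rfl⟩ := Finset.mem_image.1 this
        exact ⟨y, ⟨hy, h⟩, rfl⟩
    have hle : S.card ≤ (Finset.powersetCard (m - 1) (Finset.univ : Finset V)).card := by
      refine Finset.card_le_card_of_injOn (fun f => colourPart χ f (X.image χ)) ?_ ?_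
      · intro f hf
        refine Finset.mem_coe.2 (Finset.mem_powersetCard.2 ⟨Finset.subset_univ _, ?_⟩)
        have h1 := Finset.card_image_of_injOn (s := colourPart χ f (X.image χ)) (f := χ)
          ((hrb f hf).mono (by exact_mod_cast Finset.filter_subset _ _))
        rw [hpartim f hf, Finset.card_image_of_injOn hinjX, hXc] at h1
        exact h1.symm
      -- If `f` and `g` agree on the colours of `X`, the transport of `f ∩ g` to `e` contains `X`,
      -- hence is all of `e`. Then `f ∩ g` carries every colour and `f = g`.
      · intro f hf g hg hfg
        simp only at hfg
        have hsub1 : colourPart χ f (X.image χ) ⊆ f ∩ g :=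
          Finset.subset_inter (Finset.filter_subset _ _) (hfg ▸ Finset.filter_subset _ _)
        have hXsub : X ⊆ colourPart χ e ((f ∩ g).image χ) := by
          intro x hx
          refine Finset.mem_filter.2 ⟨hX hx, ?_⟩
          refine Finset.image_subset_image hsub1 ?_
          rw [hpartim f hf]
          exact Finset.mem_image_of_mem _ hx
        have hfull := hown _ ⟨f, hf, g, hg, rfl⟩ hXsub
        have himg : (f ∩ g).image χ = Finset.univ := by
          refine Finset.eq_univ_of_forall fun c => ?_
          have : c ∈ e.image χ := by rw [hbij e he]; exact Finset.mem_univ _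
          obtain ⟨y, hy, rfl⟩ := Finset.mem_image.1 this
          rw [← hfull] at hy
          exact (Finset.mem_filter.1 hy).2
        have hc : m * t ≤ (f ∩ g).card := by
          have := Finset.card_image_le (s := f ∩ g) (f := χ)
          rwa [himg, Finset.card_univ, Fintype.card_fin] at this
        have hf' : f ∩ g = f := Finset.eq_of_subset_of_card_le Finset.inter_subset_left
          (by rw [hSu f hf]; exact hc)
        have hg' : f ∩ g = g := Finset.eq_of_subset_of_card_le Finset.inter_subset_right
          (by rw [hSu g hg]; exact hc)
        exact hf'.symm.trans hg'
    rw [Finset.card_powersetCard, Finset.card_univ] at hle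
    exact hle.trans (Nat.choose_le_pow _ _)

variable {m t : ℕ} {H : Finset (Finset V)}

theorem IsKernel.size_inter (hu : ∀ e ∈ H, e.card = m * t)
    (hL : ∀ e ∈ H, ∀ f ∈ H, t ∣ (e ∩ f).card ∨ m * (t - 1) ≤ (e ∩ f).card)
    {A B : Finset V} (hA : IsKernel (m * t) H A) (hB : IsKernel (m * t) H B) :
    t ∣ (A ∩ B).card ∨ m * (t - 1) ≤ (A ∩ B).card := by
  obtain ⟨e, he, f, hf, h⟩ := hA.exists_inter_eq hu hB
  rw [← h]
  exact hL e he f hf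

/-- Either form of a permissible nonzero size is at least `t`, because `m * (t - 1) ≥ m ≥ t`. -/
theorem team_disjoint_or_subset (ht : 2 ≤ t) (htm : t ≤ m) (hu : ∀ e ∈ H, e.card = m * t)
    (hL : ∀ e ∈ H, ∀ f ∈ H, t ∣ (e ∩ f).card ∨ m * (t - 1) ≤ (e ∩ f).card)
    {A B : Finset V} (hAt : A.card = t) (hA : IsKernel (m * t) H A)
    (hB : IsKernel (m * t) H B) : Disjoint A B ∨ A ⊆ B := by
  by_cases h0 : (A ∩ B).card = 0
  · left
    rw [Finset.disjoint_iff_inter_eq_empty]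
    exact Finset.card_eq_zero.1 h0
  · right
    have h1 : t ≤ (A ∩ B).card := by
      rcases hA.size_inter hu hL hB with h | h
      · exact Nat.le_of_dvd (by omega) h
      · have : m * 1 ≤ m * (t - 1) := Nat.mul_le_mul_left _ (by omega)
        omega
    exact Finset.inter_eq_left.1
      (Finset.eq_of_subset_of_card_le Finset.inter_subset_left (by omega))

/-- For `K ≠ L` the size of `K ∩ L` is below `m * (t - 1)`, hence divisible by `t`. Adding `x` to
both raises it by one, and neither alternative for a permissible size survives. -/
theorem core_extension_unique (ht : 2 ≤ t) (htm : t ∣ m) (hu : ∀ e ∈ H, e.card = m * t)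
    (hL : ∀ e ∈ H, ∀ f ∈ H, t ∣ (e ∩ f).card ∨ m * (t - 1) ≤ (e ∩ f).card)
    {K L : Finset V} {x : V} (hKc : K.card = m * (t - 1)) (hLc : L.card = m * (t - 1))
    (hK : IsKernel (m * t) H K) (hL' : IsKernel (m * t) H L)
    (hxK : x ∉ K) (hKx : IsKernel (m * t) H (insert x K))
    (hLx : IsKernel (m * t) H (insert x L)) : K = L := by
  by_contra hne
  have hlt : (K ∩ L).card < m * (t - 1) := by
    rw [← hKc]
    refine Finset.card_lt_card (Finset.inter_subset_left.ssubset_of_ne fun h => hne ?_)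
    exact Finset.eq_of_subset_of_card_le (Finset.inter_eq_left.1 h) (by omega)
  have hd : t ∣ (K ∩ L).card := by
    rcases hK.size_inter hu hL hL' with h | h
    · exact h
    · omega
  have h2 := hKx.size_inter hu hL hLx
  rw [← Finset.insert_inter_distrib, Finset.card_insert_of_notMem
    (fun h => hxK (Finset.mem_inter.1 h).1)] at h2
  have hn1 : ¬ t ∣ 1 := fun h => by
    have := Nat.le_of_dvd one_pos h
    omega
  rcases h2 with h2 | h2
  · exact hn1 ((Nat.dvd_add_right hd).1 h2)
  · have h3 : m * (t - 1) = (K ∩ L).card + 1 := by omega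
    exact hn1 ((Nat.dvd_add_right hd).1 (h3 ▸ htm.mul_right _))

/-- A team through `x` is not inside `K`, so it is disjoint from `K`; it meets `insert x K`, so it
lies inside that set. It would be `{x}`, but `t ≥ 2`. -/
theorem team_disjoint_core_extension (ht : 2 ≤ t) (htm : t ≤ m)
    (hu : ∀ e ∈ H, e.card = m * t)
    (hL : ∀ e ∈ H, ∀ f ∈ H, t ∣ (e ∩ f).card ∨ m * (t - 1) ≤ (e ∩ f).card)
    {A K : Finset V} {x : V} (hAt : A.card = t) (hA : IsKernel (m * t) H A)
    (hK : IsKernel (m * t) H K) (hxK : x ∉ K) (hKx : IsKernel (m * t) H (insert x K)) :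
    x ∉ A := by
  intro hxA
  have h1 : Disjoint A K := (team_disjoint_or_subset ht htm hu hL hAt hA hK).resolve_right
    fun h => hxK (h hxA)
  have h2 : A ⊆ insert x K := (team_disjoint_or_subset ht htm hu hL hAt hA hKx).resolve_left
    fun h => Finset.disjoint_left.1 h hxA (Finset.mem_insert_self _ _)
  have h3 : A ⊆ {x} := by
    intro y hy
    rcases Finset.mem_insert.1 (h2 hy) with rfl | hyK
    · simp
    · exact absurd hyK (Finset.disjoint_left.1 h1 hy)
  have := Finset.card_le_card h3
  simp at this
  omega

end Shapes

/-! ### Counting edges by teams, cores and traces on the rest -/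

section Counting

variable {V : Type*} [Fintype V] [DecidableEq V]

open Classical in
/-- The kernels of size `t`. -/
noncomputable def teams (k t : ℕ) (H : Finset (Finset V)) : Finset (Finset V) :=
  Finset.univ.filter (fun A => A.card = t ∧ IsKernel k H A)

/-- The vertices outside all teams. -/
noncomputable def rest (k t : ℕ) (H : Finset (Finset V)) : Finset V :=
  Finset.univ \ (teams k t H).biUnion id

/-- The teams contained in `e`. -/
noncomputable def teamsIn (k t : ℕ) (H : Finset (Finset V)) (e : Finset V) : Finset (Finset V) :=
  (teams k t H).filter (fun A => A ⊆ e)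

theorem mem_teams {k t : ℕ} {H : Finset (Finset V)} {A : Finset V} :
    A ∈ teams k t H ↔ A.card = t ∧ IsKernel k H A := by
  simp [teams]

theorem mem_rest {k t : ℕ} {H : Finset (Finset V)} {x : V} :
    x ∈ rest k t H ↔ ∀ A ∈ teams k t H, x ∉ A := by
  simp [rest]

theorem mem_teamsIn {k t : ℕ} {H : Finset (Finset V)} {A e : Finset V} :
    A ∈ teamsIn k t H e ↔ A ∈ teams k t H ∧ A ⊆ e := by
  simp [teamsIn]

variable {m t : ℕ} {H : Finset (Finset V)}

theorem teams_pairwiseDisjoint (ht : 2 ≤ t) (htm : t ≤ m) (hu : ∀ e ∈ H, e.card = m * t)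
    (hL : ∀ e ∈ H, ∀ f ∈ H, t ∣ (e ∩ f).card ∨ m * (t - 1) ≤ (e ∩ f).card) :
    (teams (m * t) t H : Set (Finset V)).PairwiseDisjoint id := by
  intro A hA B hB hne
  obtain ⟨hAt, hA⟩ := mem_teams.1 hA
  obtain ⟨hBt, hB⟩ := mem_teams.1 hB
  refine (team_disjoint_or_subset ht htm hu hL hAt hA hB).resolve_right fun h => hne ?_
  exact Finset.eq_of_subset_of_card_le h (by omega)

theorem card_teams_mul_add (ht : 2 ≤ t) (htm : t ≤ m) (hu : ∀ e ∈ H, e.card = m * t)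
    (hL : ∀ e ∈ H, ∀ f ∈ H, t ∣ (e ∩ f).card ∨ m * (t - 1) ≤ (e ∩ f).card) :
    t * (teams (m * t) t H).card + (rest (m * t) t H).card = Fintype.card V := by
  have h1 := Finset.card_sdiff_add_card_eq_card
    (Finset.subset_univ ((teams (m * t) t H).biUnion id))
  rw [Finset.card_biUnion (fun A hA B hB hne =>
    teams_pairwiseDisjoint ht htm hu hL hA hB hne)] at h1
  rw [Finset.sum_congr rfl (f := fun A => (id A).card) (g := fun _ => t) (fun A hA => (mem_teams.1 hA).1), Finset.sum_const, smul_eq_mul,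
    Finset.card_univ] at h1
  rw [rest, mul_comm t]
  omega

theorem edge_eq_union (ht : 2 ≤ t) (htm : t ≤ m) (hu : ∀ e ∈ H, e.card = m * t)
    (hL : ∀ e ∈ H, ∀ f ∈ H, t ∣ (e ∩ f).card ∨ m * (t - 1) ≤ (e ∩ f).card)
    {e : Finset V} (he : e ∈ H) :
    e = (e ∩ rest (m * t) t H) ∪ (teamsIn (m * t) t H e).biUnion id := by
  ext x
  constructor
  · intro hx
    by_cases hxr : x ∈ rest (m * t) t H
    · exact Finset.mem_union_left _ (Finset.mem_inter.2 ⟨hx, hxr⟩)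
    · rw [mem_rest] at hxr
      push Not at hxr
      obtain ⟨A, hA, hxA⟩ := hxr
      refine Finset.mem_union_right _ (Finset.mem_biUnion.2 ⟨A, mem_teamsIn.2 ⟨hA, ?_⟩, hxA⟩)
      exact (team_disjoint_or_subset ht htm hu hL (mem_teams.1 hA).1 (mem_teams.1 hA).2
        (isKernel_of_mem he)).resolve_left fun h => Finset.disjoint_left.1 h hxA hx
  · intro hx
    rcases Finset.mem_union.1 hx with h | h
    · exact (Finset.mem_inter.1 h).1
    · obtain ⟨A, hA, hxA⟩ := Finset.mem_biUnion.1 h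
      exact (mem_teamsIn.1 hA).2 hxA

theorem card_edge_eq (ht : 2 ≤ t) (htm : t ≤ m) (hu : ∀ e ∈ H, e.card = m * t)
    (hL : ∀ e ∈ H, ∀ f ∈ H, t ∣ (e ∩ f).card ∨ m * (t - 1) ≤ (e ∩ f).card)
    {e : Finset V} (he : e ∈ H) :
    m * t = (e ∩ rest (m * t) t H).card + t * (teamsIn (m * t) t H e).card := by
  refine (hu e he).symm.trans ?_
  conv_lhs => rw [edge_eq_union ht htm hu hL he]
  rw [Finset.card_union_of_disjoint, Finset.card_biUnion]
  · rw [Finset.sum_congr rfl (f := fun A => (id A).card) (g := fun _ => t) (fun A hA => (mem_teams.1 (mem_teamsIn.1 hA).1).1),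
      Finset.sum_const, smul_eq_mul, mul_comm t]
  · intro A hA B hB hne
    exact teams_pairwiseDisjoint ht htm hu hL (mem_teamsIn.1 hA).1 (mem_teamsIn.1 hB).1 hne
  · rw [Finset.disjoint_left]
    intro x hx hx'
    obtain ⟨A, hA, hxA⟩ := Finset.mem_biUnion.1 hx'
    exact mem_rest.1 (Finset.mem_inter.1 hx).2 A (mem_teamsIn.1 hA).1 hxA

theorem card_edges_disjoint_rest (ht : 2 ≤ t) (htm : t ≤ m) (hu : ∀ e ∈ H, e.card = m * t)
    (hL : ∀ e ∈ H, ∀ f ∈ H, t ∣ (e ∩ f).card ∨ m * (t - 1) ≤ (e ∩ f).card) :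
    (H.filter (fun e => e ∩ rest (m * t) t H = ∅)).card ≤ (teams (m * t) t H).card.choose m := by
  rw [← Finset.card_powersetCard]
  refine Finset.card_le_card_of_injOn (teamsIn (m * t) t H) ?_ ?_
  · intro e he
    obtain ⟨he, he0⟩ := Finset.mem_filter.1 he
    refine Finset.mem_coe.2 (Finset.mem_powersetCard.2 ⟨Finset.filter_subset _ _, ?_⟩)
    have h := card_edge_eq ht htm hu hL he
    rw [he0, Finset.card_empty, zero_add, mul_comm m t] at h
    rw [mul_comm m t]
    exact (Nat.eq_of_mul_eq_mul_left (by omega) h).symm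
  · intro e he f hf hef
    obtain ⟨he, he0⟩ := Finset.mem_filter.1 he
    obtain ⟨hf, hf0⟩ := Finset.mem_filter.1 hf
    rw [edge_eq_union ht htm hu hL he, edge_eq_union ht htm hu hL hf, he0, hf0, hef]

/-- An edge is a disjoint union of teams and its trace on the rest, so the trace has size divisible
by `t`, hence 0 here. -/
theorem card_edges_of_rest_small (ht : 2 ≤ t) (htm : t ≤ m) (hu : ∀ e ∈ H, e.card = m * t)
    (hL : ∀ e ∈ H, ∀ f ∈ H, t ∣ (e ∩ f).card ∨ m * (t - 1) ≤ (e ∩ f).card)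
    (hs : (rest (m * t) t H).card < t) : H.card ≤ (teams (m * t) t H).card.choose m := by
  refine le_trans (Finset.card_le_card fun e he => ?_) (card_edges_disjoint_rest ht htm hu hL)
  refine Finset.mem_filter.2 ⟨he, ?_⟩
  have h := card_edge_eq ht htm hu hL he
  have hd : t ∣ (e ∩ rest (m * t) t H).card :=
    (Nat.dvd_add_left (dvd_mul_right t _)).1 (h ▸ dvd_mul_left t m)
  have hle : (e ∩ rest (m * t) t H).card ≤ _ := Finset.card_le_card Finset.inter_subset_right
  exact Finset.card_eq_zero.1 (Nat.eq_zero_of_dvd_of_lt hd (by omega))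

/-- Given its trace, an edge is determined by its teams, of which there are fewer than `m`. When
there are `m - 1`, the trace has size `t` but is not a kernel, so boundedly many vertices outside it
meet all these edges. Each such vertex fixes one team, leaving `m - 2` to choose. -/
theorem card_edges_of_trace (ht : 2 ≤ t) (htm : t ≤ m) (hu : ∀ e ∈ H, e.card = m * t)
    (hL : ∀ e ∈ H, ∀ f ∈ H, t ∣ (e ∩ f).card ∨ m * (t - 1) ≤ (e ∩ f).card)
    {R : Finset V} (hR : R.Nonempty) (hRr : R ⊆ rest (m * t) t H) :
    (H.filter (fun e => e ∩ rest (m * t) t H = R)).card ≤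
      m * t * Fintype.card V ^ (m - 2) := by
  have hn : 1 ≤ Fintype.card V := Fintype.card_pos_iff.2 ⟨hR.choose⟩
  have hk : 1 ≤ m * t := Nat.mul_pos (by omega) (by omega)
  have hleV : (teams (m * t) t H).card ≤ Fintype.card V := by
    have h1 := card_teams_mul_add ht htm hu hL
    have h2 : 1 * (teams (m * t) t H).card ≤ t * (teams (m * t) t H).card :=
      Nat.mul_le_mul_right _ (by omega)
    omega
  have hchoose : ∀ j ≤ m - 2, (teams (m * t) t H).card.choose j ≤ Fintype.card V ^ (m - 2) :=
    fun j hj => (Nat.choose_le_pow _ _).trans ((Nat.pow_le_pow_left hleV j).trans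
      (Nat.pow_le_pow_right hn hj))
  set Q := H.filter (fun e => e ∩ rest (m * t) t H = R) with hQ
  have hQm : ∀ e ∈ Q, e ∈ H ∧ e ∩ rest (m * t) t H = R := fun e he => Finset.mem_filter.1 he
  have hQc : ∀ e ∈ Q, m * t = R.card + t * (teamsIn (m * t) t H e).card := by
    intro e he
    have h := card_edge_eq ht htm hu hL (hQm e he).1
    rwa [(hQm e he).2] at h
  have hQinj : ∀ e ∈ Q, ∀ f ∈ Q, teamsIn (m * t) t H e = teamsIn (m * t) t H f → e = f := by
    intro e he f hf hef
    rw [edge_eq_union ht htm hu hL (hQm e he).1, edge_eq_union ht htm hu hL (hQm f hf).1,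
      (hQm e he).2, (hQm f hf).2, hef]
  rcases Q.eq_empty_or_nonempty with h0 | ⟨e₀, he₀⟩
  · simp [h0]
  have hj : ∀ e ∈ Q, (teamsIn (m * t) t H e).card = (teamsIn (m * t) t H e₀).card := by
    intro e he
    have h1 := hQc e he
    have h2 := hQc e₀ he₀
    exact Nat.eq_of_mul_eq_mul_left (show 0 < t by omega) (by omega)
  have hRpos : 0 < R.card := Finset.card_pos.2 hR
  set j := (teamsIn (m * t) t H e₀).card with hjdef
  have hjm : j < m := by
    have h := hQc e₀ he₀
    rw [← hjdef] at h
    have : t * j < t * m := by rw [mul_comm t m]; omega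
    exact lt_of_mul_lt_mul_left this (Nat.zero_le _)
  by_cases hj2 : j ≤ m - 2
  · calc Q.card ≤ (Finset.powersetCard j (teams (m * t) t H)).card := by
          refine Finset.card_le_card_of_injOn (teamsIn (m * t) t H) ?_ hQinj
          intro e he
          exact Finset.mem_coe.2 (Finset.mem_powersetCard.2
            ⟨Finset.filter_subset _ _, hj e he⟩)
      _ ≤ Fintype.card V ^ (m - 2) := by
          rw [Finset.card_powersetCard]; exact hchoose j hj2
      _ ≤ _ := Nat.le_mul_of_pos_left _ hk
  · have hRt : R.card = t := by
      have h := hQc e₀ he₀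
      obtain ⟨s, hs⟩ : ∃ s, m = s + 1 := ⟨m - 1, by omega⟩
      have hjs : (teamsIn (m * t) t H e₀).card = s := by omega
      rw [hjs, hs] at h
      have : (s + 1) * t = t + t * s := by ring
      omega
    have hRk : ¬ IsKernel (m * t) H R := by
      intro h
      obtain ⟨x, hx⟩ := hR
      exact mem_rest.1 (hRr hx) R (mem_teams.2 ⟨hRt, h⟩) hx
    unfold IsKernel at hRk
    push Not at hRk
    obtain ⟨B, hB, hRB⟩ := hRk
    have hcov : Q ⊆ (B \ R).biUnion (fun b => Q.filter (fun e => b ∈ e)) := by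
      intro e he
      have hRe : R ⊆ e := by rw [← (hQm e he).2]; exact Finset.inter_subset_left
      obtain ⟨b, hb, hbR⟩ := Finset.not_subset.1 (hRB e (hQm e he).1 hRe)
      obtain ⟨hbe, hbB⟩ := Finset.mem_inter.1 hb
      exact Finset.mem_biUnion.2 ⟨b, Finset.mem_sdiff.2 ⟨hbB, hbR⟩,
        Finset.mem_filter.2 ⟨he, hbe⟩⟩
    have hcls : ∀ b ∈ B \ R, (Q.filter (fun e => b ∈ e)).card ≤ Fintype.card V ^ (m - 2) := by
      intro b hb
      obtain ⟨hbB, hbR⟩ := Finset.mem_sdiff.1 hb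
      rcases (Q.filter (fun e => b ∈ e)).eq_empty_or_nonempty with h0 | ⟨e₁, he₁⟩
      · simp [h0]
      obtain ⟨he₁, hbe₁⟩ := Finset.mem_filter.1 he₁
      have hbr : b ∉ rest (m * t) t H := by
        intro h
        apply hbR
        rw [← (hQm e₁ he₁).2]
        exact Finset.mem_inter.2 ⟨hbe₁, h⟩
      rw [mem_rest] at hbr
      push Not at hbr
      obtain ⟨A, hA, hbA⟩ := hbr
      have hAin : ∀ e ∈ Q, b ∈ e → A ∈ teamsIn (m * t) t H e := by
        intro e he hbe
        refine mem_teamsIn.2 ⟨hA, ?_⟩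
        exact (team_disjoint_or_subset ht htm hu hL (mem_teams.1 hA).1 (mem_teams.1 hA).2
          (isKernel_of_mem (hQm e he).1)).resolve_left fun h =>
            Finset.disjoint_left.1 h hbA hbe
      calc (Q.filter (fun e => b ∈ e)).card ≤
            (Finset.powersetCard (m - 2) (teams (m * t) t H)).card := by
            refine Finset.card_le_card_of_injOn (fun e => (teamsIn (m * t) t H e).erase A) ?_ ?_
            · intro e he
              obtain ⟨he, hbe⟩ := Finset.mem_filter.1 he
              refine Finset.mem_coe.2 (Finset.mem_powersetCard.2
                ⟨(Finset.erase_subset _ _).trans (Finset.filter_subset _ _), ?_⟩)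
              rw [Finset.card_erase_of_mem (hAin e he hbe), hj e he]
              omega
            · intro e he f hf hef
              obtain ⟨he, hbe⟩ := Finset.mem_filter.1 he
              obtain ⟨hf, hbf⟩ := Finset.mem_filter.1 hf
              refine hQinj e he f hf ?_
              rw [← Finset.insert_erase (hAin e he hbe), ← Finset.insert_erase (hAin f hf hbf)]
              exact congrArg (insert A) hef
        _ ≤ _ := by rw [Finset.card_powersetCard]; exact hchoose _ le_rfl
    calc Q.card ≤ _ := Finset.card_le_card hcov
      _ ≤ ∑ b ∈ B \ R, (Q.filter (fun e => b ∈ e)).card := Finset.card_biUnion_le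
      _ ≤ (B \ R).card • Fintype.card V ^ (m - 2) := Finset.sum_le_card_nsmul _ _ _ hcls
      _ ≤ _ := by
        rw [smul_eq_mul]
        exact Nat.mul_le_mul_right _ ((Finset.card_le_card Finset.sdiff_subset).trans hB)

theorem card_le_of_rest_bounded (ht : 2 ≤ t) (htm : t ≤ m) (hu : ∀ e ∈ H, e.card = m * t)
    (hL : ∀ e ∈ H, ∀ f ∈ H, t ∣ (e ∩ f).card ∨ m * (t - 1) ≤ (e ∩ f).card) :
    H.card ≤ (teams (m * t) t H).card.choose m +
      2 ^ (rest (m * t) t H).card * (m * t * Fintype.card V ^ (m - 2)) := by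
  set U := rest (m * t) t H with hU
  have hcov : H ⊆ H.filter (fun e => e ∩ U = ∅) ∪
      (U.powerset.erase ∅).biUnion (fun R => H.filter (fun e => e ∩ U = R)) := by
    intro e he
    by_cases h : e ∩ U = ∅
    · exact Finset.mem_union_left _ (Finset.mem_filter.2 ⟨he, h⟩)
    · exact Finset.mem_union_right _ (Finset.mem_biUnion.2 ⟨e ∩ U, Finset.mem_erase.2
        ⟨h, Finset.mem_powerset.2 Finset.inter_subset_right⟩, Finset.mem_filter.2 ⟨he, rfl⟩⟩)
  refine (Finset.card_le_card hcov).trans ((Finset.card_union_le _ _).trans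
    (Nat.add_le_add (card_edges_disjoint_rest ht htm hu hL) ?_))
  refine Finset.card_biUnion_le.trans ((Finset.sum_le_card_nsmul _ _ _ fun R hR =>
    card_edges_of_trace ht htm hu hL (Finset.nonempty_iff_ne_empty.2 (Finset.mem_erase.1 hR).1)
      (Finset.mem_powerset.1 (Finset.mem_erase.1 hR).2)).trans ?_)
  rw [smul_eq_mul]
  refine Nat.mul_le_mul_right _ ((Finset.card_le_card (Finset.erase_subset _ _)).trans ?_)
  rw [Finset.card_powerset]

/-- Main counting: team edges, core edges, and a lower-order remainder. -/
theorem card_le_team_add_core_add (ht : 2 ≤ t) (htm : t ∣ m) (hm : 2 ≤ m)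
    (hu : ∀ e ∈ H, e.card = m * t)
    (hL : ∀ e ∈ H, ∀ f ∈ H, t ∣ (e ∩ f).card ∨ m * (t - 1) ≤ (e ∩ f).card) :
    ∃ (𝓚 : Finset (Finset V)) (w : Finset V → ℕ),
      ∑ K ∈ 𝓚, w K ≤ (rest (m * t) t H).card ∧
      H.card ≤ (teams (m * t) t H).card.choose m +
        ∑ K ∈ 𝓚, min ((w K).choose m) (hmaxDegree H) +
        furediConst (m * t) * Fintype.card V ^ (m - 1) := by
  classical
  have htm' : t ≤ m := Nat.le_of_dvd (by omega) htm
  have hmt : m * (t - 1) + m = m * t := by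
    obtain ⟨s, rfl⟩ : ∃ s, t = s + 1 := ⟨t - 1, by omega⟩
    simp; ring
  set k := m * t with hk
  let 𝓚 : Finset (Finset V) :=
    Finset.univ.filter (fun K => K.card = m * (t - 1) ∧ IsKernel k H K)
  -- The vertices extending the core `K`. An edge with core `K` is `K` together with `m` points of
  -- `W K`.
  let W : Finset V → Finset V :=
    fun K => Finset.univ.filter (fun x => x ∉ K ∧ IsKernel k H (insert x K))
  have hW : ∀ K x, x ∈ W K ↔ x ∉ K ∧ IsKernel k H (insert x K) := by simp [W]
  have h𝓚 : ∀ K, K ∈ 𝓚 ↔ K.card = m * (t - 1) ∧ IsKernel k H K := by simp [𝓚]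
  refine ⟨𝓚, fun K => (W K).card, ?_, ?_⟩
  · rw [← Finset.card_biUnion]
    · refine Finset.card_le_card fun x hx => ?_
      obtain ⟨K, hK, hxK⟩ := Finset.mem_biUnion.1 hx
      obtain ⟨hxn, hxk⟩ := (hW K x).1 hxK
      refine mem_rest.2 fun A hA => ?_
      exact team_disjoint_core_extension ht htm' hu hL (mem_teams.1 hA).1 (mem_teams.1 hA).2
        ((h𝓚 K).1 hK).2 hxn hxk
    · intro K hK L hL' hne
      refine Finset.disjoint_left.2 ?_
      intro x hxK hxL
      obtain ⟨h1, h2⟩ := (hW K x).1 hxK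
      obtain ⟨-, h4⟩ := (hW L x).1 hxL
      exact hne (core_extension_unique ht htm hu hL ((h𝓚 K).1 hK).1 ((h𝓚 L).1 hL').1
        ((h𝓚 K).1 hK).2 ((h𝓚 L).1 hL').2 h1 h2 h4)
  · set B := H.filter (fun e => ¬ IsTeamEdge k t H e ∧
      ∀ K, ¬ IsCoreOf k (m * (t - 1)) H K e) with hB
    have hBc := card_le_of_shapeless ht hm htm hu hL (B := B) (Finset.filter_subset _ _)
      (fun e he => (Finset.mem_filter.1 he).2.1) (fun e he => (Finset.mem_filter.1 he).2.2)
    have hcov : H ⊆ H.filter (fun e => e ∩ rest k t H = ∅) ∪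
        𝓚.biUnion (fun K => H.filter (fun e => IsCoreOf k (m * (t - 1)) H K e)) ∪ B := by
      intro e he
      by_cases h1 : IsTeamEdge k t H e
      · refine Finset.mem_union_left _ (Finset.mem_union_left _ (Finset.mem_filter.2 ⟨he, ?_⟩))
        rw [← Finset.disjoint_iff_inter_eq_empty, Finset.disjoint_left]
        intro x hx hxr
        obtain ⟨A, -, hxA, hAt, hA⟩ := h1 x hx
        exact mem_rest.1 hxr A (mem_teams.2 ⟨hAt, hA⟩) hxA
      · by_cases h2 : ∀ K, ¬ IsCoreOf k (m * (t - 1)) H K e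
        · exact Finset.mem_union_right _ (Finset.mem_filter.2 ⟨he, h1, h2⟩)
        · push Not at h2
          obtain ⟨K, hK⟩ := h2
          refine Finset.mem_union_left _ (Finset.mem_union_right _
            (Finset.mem_biUnion.2 ⟨K, ?_, Finset.mem_filter.2 ⟨he, hK⟩⟩))
          exact (h𝓚 K).2 ⟨hK.2.1, hK.2.2.1⟩
    have hcore : ∀ K ∈ 𝓚, (H.filter (fun e => IsCoreOf k (m * (t - 1)) H K e)).card ≤
        min ((W K).card.choose m) (hmaxDegree H) := by
      intro K hK
      have hKc := ((h𝓚 K).1 hK).1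
      refine le_min ?_ ?_
      · rw [← Finset.card_powersetCard]
        refine Finset.card_le_card_of_injOn (fun e => e \ K) ?_ ?_
        · intro e he
          obtain ⟨he, hKe, -, -, hext⟩ := Finset.mem_filter.1 he
          refine Finset.mem_coe.2 (Finset.mem_powersetCard.2 ⟨fun x hx => ?_, ?_⟩)
          · obtain ⟨hxe, hxK⟩ := Finset.mem_sdiff.1 hx
            exact (hW K x).2 ⟨hxK, hext x hxe hxK⟩
          · have := Finset.card_sdiff_add_card_eq_card hKe
            rw [hu e he] at this
            show (e \ K).card = m
            omega
        · intro e he f hf hef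
          obtain ⟨-, hKe, -⟩ := Finset.mem_filter.1 he
          obtain ⟨-, hKf, -⟩ := Finset.mem_filter.1 hf
          rw [← Finset.sdiff_union_of_subset hKe, ← Finset.sdiff_union_of_subset hKf]
          exact congrArg (· ∪ K) hef
      -- All edges with core `K` share the vertices of `K`, so their number is at most the degree of
      -- any one of them. Only here does the maximum degree enter.
      · have hKpos : 0 < K.card := by
          rw [hKc]; exact Nat.mul_pos (by omega) (by omega)
        obtain ⟨v, hv⟩ := Finset.card_pos.1 hKpos
        refine le_trans (Finset.card_le_card fun e he => ?_)
          (Finset.le_sup (f := hdegree H) (Finset.mem_univ v))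
        obtain ⟨he, hKe, -⟩ := Finset.mem_filter.1 he
        exact Finset.mem_filter.2 ⟨he, hKe hv⟩
    calc H.card ≤ _ := Finset.card_le_card hcov
      _ ≤ _ := Finset.card_union_le _ _
      _ ≤ _ := Nat.add_le_add (Finset.card_union_le _ _) hBc
      _ ≤ _ := by
        refine Nat.add_le_add_right (Nat.add_le_add
          (card_edges_disjoint_rest ht htm' hu hL) ?_) _
        exact Finset.card_biUnion_le.trans (Finset.sum_le_sum hcore)

end Counting

/-! ### Thick cliques: existence, size and degrees -/

section ThickClique

variable {V : Type*} [DecidableEq V]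

theorem card_biUnion_of_teams {t : ℕ} {T S : Finset (Finset V)}
    (hc : ∀ A ∈ T, A.card = t) (hd : ∀ A ∈ T, ∀ B ∈ T, A ≠ B → Disjoint A B) (hS : S ⊆ T) :
    (S.biUnion id).card = S.card * t := by
  rw [Finset.card_biUnion (t := id) (fun A hA B hB hne => hd A (hS hA) B (hS hB) hne),
    Finset.sum_congr rfl (f := fun A => (id A).card) (g := fun _ => t) (fun A hA => hc A (hS hA)),
    Finset.sum_const, smul_eq_mul]

theorem mem_biUnion_iff_of_mem_team {T S : Finset (Finset V)}
    (hd : ∀ A ∈ T, ∀ B ∈ T, A ≠ B → Disjoint A B) (hS : S ⊆ T) {A : Finset V} (hA : A ∈ T)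
    {x : V} (hx : x ∈ A) : x ∈ S.biUnion id ↔ A ∈ S := by
  constructor
  · intro h
    obtain ⟨B, hB, hxB⟩ := Finset.mem_biUnion.1 h
    by_contra hAS
    exact Finset.disjoint_left.1 (hd A hA B (hS hB) fun h => hAS (h ▸ hB)) hx hxB
  · intro h
    exact Finset.mem_biUnion.2 ⟨A, h, hx⟩

theorem biUnion_inter_biUnion_of_teams {T S S' : Finset (Finset V)}
    (hd : ∀ A ∈ T, ∀ B ∈ T, A ≠ B → Disjoint A B) (hS : S ⊆ T) (hS' : S' ⊆ T) :
    S.biUnion id ∩ S'.biUnion id = (S ∩ S').biUnion id := by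
  ext x
  constructor
  · intro hx
    obtain ⟨h1, h2⟩ := Finset.mem_inter.1 hx
    obtain ⟨A, hA, hxA⟩ := Finset.mem_biUnion.1 h1
    exact Finset.mem_biUnion.2 ⟨A, Finset.mem_inter.2
      ⟨hA, (mem_biUnion_iff_of_mem_team hd hS' (hS hA) hxA).1 h2⟩, hxA⟩
  · intro hx
    obtain ⟨A, hA, hxA⟩ := Finset.mem_biUnion.1 hx
    obtain ⟨h1, h2⟩ := Finset.mem_inter.1 hA
    exact Finset.mem_inter.2 ⟨Finset.mem_biUnion.2 ⟨A, h1, hxA⟩,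
      Finset.mem_biUnion.2 ⟨A, h2, hxA⟩⟩

theorem biUnion_injOn_of_teams {t : ℕ} (ht : 1 ≤ t) {T : Finset (Finset V)}
    (hc : ∀ A ∈ T, A.card = t) (hd : ∀ A ∈ T, ∀ B ∈ T, A ≠ B → Disjoint A B) (l : ℕ) :
    Set.InjOn (fun S : Finset (Finset V) => S.biUnion id) (T.powersetCard l) := by
  have hsub : ∀ S ⊆ T, ∀ S' ⊆ T, S.biUnion id = S'.biUnion id → S ⊆ S' := by
    intro S hS S' hS' h A hA
    obtain ⟨x, hx⟩ := Finset.card_pos.1 (show 0 < A.card by rw [hc A (hS hA)]; omega)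
    rw [← mem_biUnion_iff_of_mem_team hd hS' (hS hA) hx, ← h]
    exact Finset.mem_biUnion.2 ⟨A, hA, hx⟩
  intro S hS S' hS' h
  have h1 := (Finset.mem_powersetCard.1 (Finset.mem_coe.1 hS)).1
  have h2 := (Finset.mem_powersetCard.1 (Finset.mem_coe.1 hS')).1
  exact (hsub S h1 S' h2 h).antisymm (hsub S' h2 S h1 h.symm)

theorem card_filter_mem_powersetCard {α : Type*} [DecidableEq α] {T : Finset α} {a : α}
    (ha : a ∈ T) (l : ℕ) :
    ((T.powersetCard (l + 1)).filter (fun S => a ∈ S)).card = (T.card - 1).choose l := by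
  rw [← Finset.card_erase_of_mem ha, ← Finset.card_powersetCard]
  refine Finset.card_bij' (fun S _ => S.erase a) (fun S _ => insert a S) ?_ ?_ ?_ ?_
  · intro S hS
    obtain ⟨h1, h2⟩ := Finset.mem_filter.1 hS
    obtain ⟨h3, h4⟩ := Finset.mem_powersetCard.1 h1
    refine Finset.mem_powersetCard.2 ⟨Finset.erase_subset_erase _ h3, ?_⟩
    rw [Finset.card_erase_of_mem h2, h4]
    rfl
  · intro S hS
    obtain ⟨h3, h4⟩ := Finset.mem_powersetCard.1 hS
    have hn : a ∉ S := fun h => by simpa using h3 h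
    refine Finset.mem_filter.2 ⟨Finset.mem_powersetCard.2 ⟨Finset.insert_subset ha
      (h3.trans (Finset.erase_subset _ _)), ?_⟩, Finset.mem_insert_self _ _⟩
    rw [Finset.card_insert_of_notMem hn, h4]
  · intro S hS
    exact Finset.insert_erase (Finset.mem_filter.1 hS).2
  · intro S hS
    obtain ⟨h3, h4⟩ := Finset.mem_powersetCard.1 hS
    exact Finset.erase_insert (fun h => by simpa using h3 h)

variable [Fintype V] {t : ℕ} {T : Finset (Finset V)}

theorem IsTeamSystem.card_thickClique (hT : IsTeamSystem t T) (ht : 1 ≤ t) (l : ℕ) :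
    (thickClique l T).card = (Fintype.card V / t).choose l := by
  rw [thickClique, Finset.card_image_of_injOn
    (biUnion_injOn_of_teams ht hT.team_card hT.disjoint l), Finset.card_powersetCard, hT.card_eq]

theorem IsTeamSystem.hmaxDegree_thickClique (hT : IsTeamSystem t T) (ht : 1 ≤ t) (l : ℕ)
    (hn : t ≤ Fintype.card V) :
    hmaxDegree (thickClique (l + 1) T) = (Fintype.card V / t - 1).choose l := by
  have hdeg : ∀ A ∈ T, ∀ v ∈ A,
      hdegree (thickClique (l + 1) T) v = (Fintype.card V / t - 1).choose l := by
    intro A hA v hv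
    rw [hdegree, thickClique, Finset.filter_image, Finset.card_image_of_injOn
      ((biUnion_injOn_of_teams ht hT.team_card hT.disjoint (l + 1)).mono
        (by exact_mod_cast Finset.filter_subset _ _)),
      ← hT.card_eq, ← card_filter_mem_powersetCard hA]
    congr 1
    refine Finset.filter_congr fun S hS => ?_
    exact mem_biUnion_iff_of_mem_team hT.disjoint (Finset.mem_powersetCard.1 hS).1 hA hv
  apply le_antisymm
  · refine Finset.sup_le fun v _ => ?_
    by_cases h : ∃ A ∈ T, v ∈ A
    · obtain ⟨A, hA, hv⟩ := h
      exact (hdeg A hA v hv).le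
    · have : hdegree (thickClique (l + 1) T) v = 0 := by
        rw [hdegree, Finset.card_eq_zero, Finset.filter_eq_empty_iff]
        intro e he hve
        obtain ⟨S, hS, rfl⟩ := Finset.mem_image.1 he
        obtain ⟨A, hA, hvA⟩ := Finset.mem_biUnion.1 hve
        exact h ⟨A, (Finset.mem_powersetCard.1 hS).1 hA, hvA⟩
      rw [this]
      exact Nat.zero_le _
  · have hpos : 0 < T.card := by
      rw [hT.card_eq]
      exact Nat.div_pos hn ht
    obtain ⟨A, hA⟩ := Finset.card_pos.1 hpos
    obtain ⟨v, hv⟩ := Finset.card_pos.1 (show 0 < A.card by rw [hT.team_card A hA]; omega)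
    rw [← hdeg A hA v hv]
    exact Finset.le_sup (f := hdegree (thickClique (l + 1) T)) (Finset.mem_univ v)

theorem IsTeamSystem.isJ_thickClique (hT : IsTeamSystem t T) (r : ℕ) :
    IsJ r t (thickClique (r * t) T) := by
  constructor
  · intro e he
    obtain ⟨S, hS, rfl⟩ := Finset.mem_image.1 he
    obtain ⟨h1, h2⟩ := Finset.mem_powersetCard.1 hS
    rw [card_biUnion_of_teams hT.team_card hT.disjoint h1, h2]
    ring
  · intro e he f hf
    obtain ⟨S, hS, rfl⟩ := Finset.mem_image.1 he
    obtain ⟨S', hS', rfl⟩ := Finset.mem_image.1 hf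
    have h1 := (Finset.mem_powersetCard.1 hS).1
    have h2 := (Finset.mem_powersetCard.1 hS').1
    left
    rw [biUnion_inter_biUnion_of_teams hT.disjoint h1 h2,
      card_biUnion_of_teams hT.team_card hT.disjoint (Finset.inter_subset_left.trans h1)]
    exact dvd_mul_left _ _

theorem exists_isTeamSystem {t : ℕ} (ht : 1 ≤ t) : ∃ T : Finset (Finset V), IsTeamSystem t T := by
  have key : ∀ j, j * t ≤ Fintype.card V → ∃ T : Finset (Finset V), T.card = j ∧
      (∀ A ∈ T, A.card = t) ∧ ∀ A ∈ T, ∀ B ∈ T, A ≠ B → Disjoint A B := by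
    intro j
    induction j with
    | zero => exact fun _ => ⟨∅, by simp⟩
    | succ j ih =>
      intro hj
      rw [add_mul, one_mul] at hj
      obtain ⟨T, h1, h2, h3⟩ := ih (by omega)
      have hU := card_biUnion_of_teams h2 h3 subset_rfl
      have hc : t ≤ (Finset.univ \ T.biUnion id).card := by
        rw [Finset.card_sdiff_of_subset (Finset.subset_univ _), hU, h1, Finset.card_univ]
        omega
      obtain ⟨A, hA, hAt⟩ := Finset.exists_subset_card_eq hc
      have hdis : ∀ B ∈ T, Disjoint A B := by
        intro B hB
        rw [Finset.disjoint_left]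
        intro x hx hxB
        exact (Finset.mem_sdiff.1 (hA hx)).2 (Finset.mem_biUnion.2 ⟨B, hB, hxB⟩)
      have hAT : A ∉ T := by
        intro h
        have := hdis A h
        rw [disjoint_self, Finset.bot_eq_empty] at this
        rw [this, Finset.card_empty] at hAt
        omega
      refine ⟨insert A T, by rw [Finset.card_insert_of_notMem hAT, h1], ?_, ?_⟩
      · intro B hB
        rcases Finset.mem_insert.1 hB with rfl | hB
        · exact hAt
        · exact h2 B hB
      · intro B hB C hC hne
        rcases Finset.mem_insert.1 hB with hB | hB <;> rcases Finset.mem_insert.1 hC with hC | hC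
        · exact absurd (hB.trans hC.symm) hne
        · exact hB ▸ hdis C hC
        · exact hC ▸ (hdis B hB).symm
        · exact h3 B hB C hC hne
  obtain ⟨T, h1, h2, h3⟩ := key (Fintype.card V / t) (Nat.div_mul_le_self _ _)
  exact ⟨T, h1, h2, h3⟩

end ThickClique

/-! ### Numerical estimates -/

section Estimates

theorem exists_root_of_pow {m : ℕ} (hm : m ≠ 0) {x : ℝ} (hx : 0 ≤ x) :
    ∃ y : ℝ, 0 ≤ y ∧ y ^ m = x :=
  ⟨x ^ ((m : ℝ)⁻¹), Real.rpow_nonneg hx _, Real.rpow_inv_natCast_pow hx hm⟩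

theorem three_mul_lt_three_pow {m : ℕ} (hm : 2 ≤ m) : (3 * m : ℝ) < 3 ^ m := by
  induction m, hm using Nat.le_induction with
  | base => norm_num
  | succ n hn ih =>
    rw [pow_succ]
    have : (2 : ℝ) ≤ n := by exact_mod_cast hn
    push_cast
    linarith

theorem div_sub_le_of_choose_le {t m n : ℕ} (ht : 1 ≤ t) (hm : 1 ≤ m) {E : ℝ} (hE : 0 ≤ E)
    (h : (m.factorial * (n / t).choose m : ℝ) ≤ E ^ m) : (n : ℝ) / t - m ≤ E := by
  have h1 := Nat.pow_le_choose (α := ℝ) m (n / t)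
  rw [div_le_iff₀' (by positivity)] at h1
  have h2 : ((n / t + 1 - m : ℕ) : ℝ) ≤ E :=
    (pow_le_pow_iff_left₀ (Nat.cast_nonneg _) hE (Nat.one_le_iff_ne_zero.1 hm)).1 (h1.trans h)
  have h3 : ((n / t + 1 : ℕ) : ℝ) ≤ ((n / t + 1 - m : ℕ) : ℝ) + m := by
    exact_mod_cast (by omega : n / t + 1 ≤ (n / t + 1 - m) + m)
  have h4 : (n : ℝ) / t ≤ ((n / t + 1 : ℕ) : ℝ) := by
    have ht' : (0 : ℝ) < t := by exact_mod_cast ht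
    rw [div_le_iff₀ ht']
    exact_mod_cast (Nat.lt_mul_of_div_lt (Nat.lt_succ_self _) ht).le
  linarith

/-- If the part outside the teams is large, the main counting bound is incompatible with
many edges of small degree. -/
theorem exists_rest_bound {t m : ℕ} (ht : 2 ≤ t) (htm : t ≤ m) (C : ℕ) :
    ∃ D : ℕ, ∀ {ι : Type*} (S : Finset ι) (w : ι → ℕ) (n a u e Δ : ℕ),
      2 * t * m ≤ n → t * a + u = n → D ≤ u → (n / t).choose m ≤ e →
      (Δ : ℝ) ≤ (e : ℝ) / (3 * t) → ∑ i ∈ S, w i ≤ u →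
      a.choose m + ∑ i ∈ S, min ((w i).choose m) Δ + C * n ^ (m - 1) < e := by
  have ht0 : (0 : ℝ) < t := by exact_mod_cast (by omega : 0 < t)
  have ht1 : (2 : ℝ) ≤ t := by exact_mod_cast ht
  have htm' : (t : ℝ) ≤ m := by exact_mod_cast htm
  have hm0 : m ≠ 0 := by omega
  -- `θ * E`, with `E ^ m = m! * e`, is the number of core vertices at which the bounds `w ^ m / m!`
  -- and `e / (3 * t)` coincide. The constant 3 enters through `3 * t ≤ 3 * m < 3 ^ m`, which gives
  -- `θ > 1 / 3` and hence `γ < 1` below.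
  obtain ⟨θ, hθ0, hθm⟩ := exists_root_of_pow hm0 (show (0 : ℝ) ≤ 1 / (3 * t) by positivity)
  have hθ : 1 / 3 < θ := by
    by_contra! h
    have h1 := pow_le_pow_left₀ hθ0 h m
    rw [hθm, div_pow, one_pow, one_div_le_one_div (by positivity) (by positivity)] at h1
    have := three_mul_lt_three_pow (show 2 ≤ m by omega)
    linarith
  have hθm1 : θ ^ (m - 1) = 1 / (3 * θ) / t := by
    have h1 : θ ^ (m - 1) * θ = 1 / (3 * t) := by
      rw [← hθm, ← pow_succ]; congr 1; omega
    have hθne : θ ≠ 0 := by linarith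
    field_simp at h1 ⊢
    linarith
  have hgap : 0 < 1 - 1 / (3 * θ) := by
    rw [sub_pos, div_lt_one (by linarith)]
    linarith
  set γ := 1 / (3 * θ) with hγ
  have hγ0 : 0 < γ := by positivity
  set M : ℝ := m.factorial * C * (2 * t) ^ (m - 1) with hM
  obtain ⟨D, hD⟩ := exists_nat_gt ((M + m) * t / (1 - γ))
  -- The summand `t * m` makes `u / t ≥ m`, which absorbs the rounding in `E ≥ n / t - m` and yields
  -- `a ≤ E`.
  refine ⟨D + t * m, ?_⟩
  intro ι S w n a u e Δ hn hau hu hNe hΔ hw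
  by_contra! hcon
  have hfac : (0 : ℝ) < m.factorial := by positivity
  obtain ⟨E, hE0, hE⟩ := exists_root_of_pow hm0 (show (0 : ℝ) ≤ m.factorial * e by positivity)
  have hElow : (n : ℝ) / t - m ≤ E := by
    refine div_sub_le_of_choose_le (by omega) (by omega) hE0 ?_
    rw [hE]
    exact mul_le_mul_of_nonneg_left (by exact_mod_cast hNe) hfac.le
  have hnt : (n : ℝ) / t = a + u / t := by
    rw [← hau]; push_cast; field_simp
  have hu' : (D : ℝ) + t * m ≤ u := by exact_mod_cast hu
  have hum : (m : ℝ) ≤ u / t := by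
    rw [le_div_iff₀ ht0]
    have : (0 : ℝ) ≤ D := Nat.cast_nonneg _
    linarith
  have haE : (a : ℝ) ≤ E := by linarith
  have hn' : 2 * t * m ≤ (n : ℝ) := by exact_mod_cast hn
  have hnE : (n : ℝ) / (2 * t) ≤ E := by
    have h1 : (m : ℝ) ≤ n / (2 * t) := by
      rw [le_div_iff₀ (by positivity)]; linarith
    have h2 : (n : ℝ) / t = n / (2 * t) + n / (2 * t) := by field_simp; ring
    linarith
  have hchoose : ∀ x : ℕ, (m.factorial : ℝ) * (x.choose m : ℝ) ≤ (x : ℝ) ^ m := by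
    intro x
    have := Nat.choose_le_pow_div (α := ℝ) m x
    rwa [le_div_iff₀' hfac] at this
  -- Linearisation of the core term: below `θ * E` use the binomial bound, above it the degree
  -- bound. A vertex in a core extension then contributes at most `(θ * E) ^ (m - 1) = E ^ (m - 1) *
  -- γ / t`.
  have hmin : ∀ x : ℕ, (m.factorial : ℝ) * (min (x.choose m) Δ : ℕ) ≤
      (θ * E) ^ (m - 1) * x := by
    intro x
    have hm1 : ∀ y : ℝ, y ^ m = y ^ (m - 1) * y := by
      intro y; rw [← pow_succ]; congr 1; omega
    by_cases hx : (x : ℝ) ≤ θ * E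
    · calc (m.factorial : ℝ) * (min (x.choose m) Δ : ℕ) ≤ m.factorial * (x.choose m : ℝ) :=
            mul_le_mul_of_nonneg_left (by exact_mod_cast min_le_left _ _) hfac.le
        _ ≤ (x : ℝ) ^ m := hchoose x
        _ = (x : ℝ) ^ (m - 1) * x := hm1 _
        _ ≤ _ := by gcongr
    · calc (m.factorial : ℝ) * (min (x.choose m) Δ : ℕ) ≤ m.factorial * (Δ : ℝ) :=
            mul_le_mul_of_nonneg_left (by exact_mod_cast min_le_right _ _) hfac.le
        _ ≤ m.factorial * ((e : ℝ) / (3 * t)) := mul_le_mul_of_nonneg_left hΔ hfac.le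
        _ = (θ * E) ^ m := by rw [mul_pow, hθm, hE]; ring
        _ = (θ * E) ^ (m - 1) * (θ * E) := hm1 _
        _ ≤ _ := by
          refine mul_le_mul_of_nonneg_left (not_le.1 hx).le (by positivity)
  have hmain : E ^ m ≤ (a : ℝ) ^ m + (θ * E) ^ (m - 1) * u +
      m.factorial * C * (n : ℝ) ^ (m - 1) := by
    have h1 : (e : ℝ) ≤ (a.choose m : ℝ) + ∑ i ∈ S, ((min ((w i).choose m) Δ : ℕ) : ℝ) +
        C * (n : ℝ) ^ (m - 1) := by exact_mod_cast hcon
    have h2 : (m.factorial : ℝ) * ∑ i ∈ S, ((min ((w i).choose m) Δ : ℕ) : ℝ) ≤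
        (θ * E) ^ (m - 1) * u := by
      rw [Finset.mul_sum]
      calc _ ≤ ∑ i ∈ S, (θ * E) ^ (m - 1) * (w i : ℝ) := Finset.sum_le_sum fun i _ => hmin (w i)
        _ = (θ * E) ^ (m - 1) * ∑ i ∈ S, (w i : ℝ) := by rw [Finset.mul_sum]
        _ ≤ _ := mul_le_mul_of_nonneg_left (by exact_mod_cast hw) (by positivity)
    have h3 := mul_le_mul_of_nonneg_left h1 hfac.le
    have h4 := hchoose a
    rw [hE]
    linarith
  have hpow : E ^ (m - 1) * (E - a - γ * u / t) ≤ m.factorial * C * (n : ℝ) ^ (m - 1) := by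
    have h1 : E ^ m = E ^ (m - 1) * E := by rw [← pow_succ]; congr 1; omega
    have h2 : (a : ℝ) ^ m ≤ E ^ (m - 1) * a := by
      calc (a : ℝ) ^ m = (a : ℝ) ^ (m - 1) * a := by rw [← pow_succ]; congr 1; omega
        _ ≤ _ := by gcongr
    have h3 : (θ * E) ^ (m - 1) * u = E ^ (m - 1) * (γ * u / t) := by
      rw [mul_pow, hθm1]; ring
    rw [h3] at hmain
    linarith
  -- Since `E ≥ a + u / t - m`, the difference is at least `(1 - γ) * u / t - m`, and `D` was chosen
  -- to make this exceed `M`.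
  have hlow : M < E - a - γ * u / t := by
    rw [div_lt_iff₀ hgap] at hD
    have h1 : (M + m) * t < u * (1 - γ) := by
      refine hD.trans_le (mul_le_mul_of_nonneg_right ?_ hgap.le)
      have : (0 : ℝ) ≤ t * m := by positivity
      linarith
    have h2 : M + m < u * (1 - γ) / t := by rwa [lt_div_iff₀ ht0]
    have h3 : (u : ℝ) * (1 - γ) / t = u / t - γ * u / t := by ring
    linarith
  have hnpos : 0 < (n : ℝ) := by
    have : (0 : ℝ) < 2 * t * m := by
      have : (0 : ℝ) < m := by linarith
      positivity
    linarith
  have hM0 : 0 ≤ M := by positivity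
  have hfinal : ((n : ℝ) / (2 * t)) ^ (m - 1) * (E - a - γ * u / t) ≤
      m.factorial * C * (n : ℝ) ^ (m - 1) :=
    (mul_le_mul_of_nonneg_right (pow_le_pow_left₀ (by positivity) hnE _)
      (hM0.trans hlow.le)).trans hpow
  have hstrict : ((n : ℝ) / (2 * t)) ^ (m - 1) * M <
      ((n : ℝ) / (2 * t)) ^ (m - 1) * (E - a - γ * u / t) :=
    mul_lt_mul_of_pos_left hlow (by positivity)
  have heq : ((n : ℝ) / (2 * t)) ^ (m - 1) * M = m.factorial * C * (n : ℝ) ^ (m - 1) := by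
    rw [hM, div_pow]
    field_simp
  linarith

/-- If the part outside the teams is bounded, a missing team costs more than the edges
meeting that part can contribute. -/
theorem exists_order_bound {t m : ℕ} (ht : 2 ≤ t) (hm : 2 ≤ m) (C : ℕ) :
    ∃ n₀ : ℕ, ∀ n a : ℕ, n₀ ≤ n → a + 1 ≤ n / t →
      a.choose m + C * n ^ (m - 2) ≤ (n / t).choose m := by
  -- By Pascal's rule a missing team costs at least `N.choose (m - 1)` with `N = n / t - 1`. This is
  -- at least `P ^ (m - 1) / (m - 1)!`, and `n ≤ 2 * t * P`, so `P ≥ Q` suffices.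
  set Q := C * ((m - 1).factorial * (2 * t) ^ (m - 2)) with hQ
  refine ⟨t * (2 * m + Q), fun n a hn ha => ?_⟩
  have hN : 2 * m + Q ≤ n / t := by
    rw [Nat.le_div_iff_mul_le (by omega), mul_comm]; exact hn
  obtain ⟨N, hNdef⟩ : ∃ N, n / t = N + 1 := ⟨n / t - 1, by omega⟩
  obtain ⟨l, rfl⟩ : ∃ l, m = l + 2 := ⟨m - 2, by omega⟩
  have hnlt : n < t * (N + 1 + 1) := by
    rw [← hNdef]; exact Nat.lt_mul_div_succ n (by omega)
  rw [hNdef] at hN ha ⊢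
  set P := N + 1 - (l + 1) with hP
  have hnP : n ≤ 2 * t * P := by
    have : t * (N + 1 + 1) ≤ t * (2 * P) := Nat.mul_le_mul_left _ (by omega)
    calc n ≤ t * (N + 1 + 1) := hnlt.le
      _ ≤ t * (2 * P) := this
      _ = 2 * t * P := by ring
  have hQP : Q ≤ P := by omega
  have hdesc : P ^ (l + 1) ≤ (l + 1).factorial * N.choose (l + 1) := by
    rw [← Nat.descFactorial_eq_factorial_mul_choose]
    exact Nat.pow_sub_le_descFactorial N (l + 1)
  have key : C * n ^ l ≤ N.choose (l + 1) := by
    refine le_of_mul_le_mul_left ?_ (Nat.factorial_pos (l + 1))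
    calc (l + 1).factorial * (C * n ^ l) ≤ (l + 1).factorial * (C * (2 * t * P) ^ l) := by gcongr
      _ = Q * P ^ l := by
        rw [hQ]
        simp only [Nat.add_sub_cancel, show l + 2 - 1 = l + 1 from rfl]
        rw [mul_pow]; ring
      _ ≤ P * P ^ l := Nat.mul_le_mul_right _ hQP
      _ = P ^ (l + 1) := by ring
      _ ≤ _ := hdesc
  rw [Nat.choose_succ_succ' N (l + 1), add_comm (N.choose (l + 1))]
  exact Nat.add_le_add (Nat.choose_le_choose _ (by omega)) key

/-- The ratio of the two binomial coefficients is exactly `m / N`. -/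
theorem choose_pred_lt {t m N : ℕ} (ht : 1 ≤ t) (hm : 1 ≤ m) (hN : 3 * t * m < N) :
    ((N - 1).choose (m - 1) : ℝ) < (N.choose m : ℝ) / (3 * t) := by
  obtain ⟨M, rfl⟩ : ∃ M, N = M + 1 := ⟨N - 1, by omega⟩
  obtain ⟨l, rfl⟩ : ∃ l, m = l + 1 := ⟨m - 1, by omega⟩
  have h1 := Nat.add_one_mul_choose_eq M l
  have hle : 1 * (l + 1) ≤ 3 * t * (l + 1) := Nat.mul_le_mul_right _ (by omega)
  have hpos : 0 < M.choose l := Nat.choose_pos (by omega)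
  have ht' : (0 : ℝ) < 3 * t := by
    have : (0 : ℝ) < t := by exact_mod_cast ht
    linarith
  rw [lt_div_iff₀ ht']
  simp only [Nat.add_sub_cancel]
  have h2 : M.choose l * (3 * t) * (l + 1) < (M + 1).choose (l + 1) * (l + 1) := by
    rw [← h1, mul_assoc, mul_comm (M + 1)]
    exact Nat.mul_lt_mul_of_pos_left hN hpos
  exact_mod_cast lt_of_mul_lt_mul_right h2 (Nat.zero_le _)

end Estimates

/-! ### Assembly of the theorem -/

theorem exists_maxDegree_bound {r t : ℕ} (hr : 1 ≤ r) (ht : 2 ≤ t) :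
    ∃ n₀ : ℕ, ∀ (V : Type*) [Fintype V] [DecidableEq V], n₀ ≤ Fintype.card V →
      ∀ H : Finset (Finset V), IsJ r t H → (Fintype.card V / t).choose (r * t) + 1 ≤ H.card →
        (H.card : ℝ) / (3 * (t : ℝ)) ≤ (hmaxDegree H : ℝ) := by
  have htm : t ≤ r * t := Nat.le_mul_of_pos_left _ hr
  have hm : 2 ≤ r * t := ht.trans htm
  have hdvd : t ∣ r * t := dvd_mul_left t r
  obtain ⟨D, hD⟩ := exists_rest_bound ht htm (furediConst (r * t * t))
  obtain ⟨n₁, hn₁⟩ := exists_order_bound ht hm (2 ^ D * (r * t * t))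
  refine ⟨n₁ + 2 * t * (r * t), fun V _ _ hn H hH he => ?_⟩
  have hu : ∀ e ∈ H, e.card = r * t * t := fun e he => by rw [hH.uniform e he]; ring
  have hL := hH.inter
  by_contra! hdeg
  have hau := card_teams_mul_add ht htm hu hL
  -- Three ranges for the number of vertices outside teams: at least `D`, less than `t`, and the
  -- bounded range between, where at least one team is missing.
  by_cases hD' : D ≤ (rest (r * t * t) t H).card
  · obtain ⟨𝓚, w, hw, hc⟩ := card_le_team_add_core_add ht hdvd hm hu hL
    exact absurd hc (not_le.2 (hD 𝓚 w _ _ _ _ _ (by omega) hau hD' (by omega) hdeg.le hw))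
  · by_cases hs : (rest (r * t * t) t H).card < t
    · have h1 := card_edges_of_rest_small ht htm hu hL hs
      have h2 : (teams (r * t * t) t H).card ≤ Fintype.card V / t := by
        rw [Nat.le_div_iff_mul_le (by omega), mul_comm]
        omega
      have h3 := Nat.choose_le_choose (r * t) h2
      omega
    · have h1 := card_le_of_rest_bounded ht htm hu hL
      have h2 : (teams (r * t * t) t H).card + 1 ≤ Fintype.card V / t := by
        rw [Nat.le_div_iff_mul_le (by omega), mul_comm, mul_add, mul_one]
        omega
      have h3 := hn₁ _ _ (by omega : n₁ ≤ Fintype.card V) h2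
      have h4 : 2 ^ (rest (r * t * t) t H).card * (r * t * t * Fintype.card V ^ (r * t - 2)) ≤
          2 ^ D * (r * t * t) * Fintype.card V ^ (r * t - 2) := by
        rw [mul_assoc (2 ^ D)]
        exact Nat.mul_le_mul_right _ (Nat.pow_le_pow_right (by omega) (by omega))
      omega

theorem theorem1p1 (r t : ℕ) (hr : 1 ≤ r) (ht : 2 ≤ t) :
    (∃ n₀ : ℕ, ∀ (V : Type*) [Fintype V] [DecidableEq V], n₀ ≤ Fintype.card V →
      -- every member of the class with more edges than the thick clique has large maximum degree
      (∀ H : Finset (Finset V), IsJ r t H →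
        (Fintype.card V / t).choose (r * t) + 1 ≤ H.card →
        (H.card : ℝ) / (3 * (t : ℝ)) ≤ (hmaxDegree H : ℝ)) ∧
      -- the bound on the number of edges is sharp: it fails for thick cliques
      (∀ T : Finset (Finset V), IsTeamSystem t T →
        (hmaxDegree (thickClique (r * t) T) : ℝ) <
          ((thickClique (r * t) T).card : ℝ) / (3 * (t : ℝ)))) ∧
    (∀ (V : Type*) [Fintype V] [DecidableEq V], r * t ^ 2 ≤ Fintype.card V →
      (∃ T : Finset (Finset V), IsTeamSystem t T) ∧
      (∀ T : Finset (Finset V), IsTeamSystem t T →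
        IsJ r t (thickClique (r * t) T) ∧
        (thickClique (r * t) T).card = (Fintype.card V / t).choose (r * t) ∧
        hmaxDegree (thickClique (r * t) T) =
          (Fintype.card V / t - 1).choose (r * t - 1))) := by
  have hm : 1 ≤ r * t := Nat.mul_pos hr (by omega)
  have ht1 : 1 ≤ t := by omega
  constructor
  · obtain ⟨n₀, h₀⟩ := exists_maxDegree_bound hr ht
    refine ⟨n₀ + t * (3 * t * (r * t) + 1), fun V _ _ hn => ⟨h₀ V (by omega), fun T hT => ?_⟩⟩
    have hN : 3 * t * (r * t) + 1 ≤ Fintype.card V / t := by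
      rw [Nat.le_div_iff_mul_le ht1, mul_comm]
      omega
    have htV : t ≤ Fintype.card V := by
      have : t * 1 ≤ t * (3 * t * (r * t) + 1) := Nat.mul_le_mul_left _ (by omega)
      omega
    have hdeg := hT.hmaxDegree_thickClique ht1 (r * t - 1) htV
    rw [Nat.sub_add_cancel hm] at hdeg
    rw [hdeg, hT.card_thickClique ht1]
    exact choose_pred_lt ht1 hm hN
  · intro V _ _ hn
    refine ⟨exists_isTeamSystem ht1, fun T hT =>
      ⟨hT.isJ_thickClique r, hT.card_thickClique ht1 _, ?_⟩⟩
    have htV : t ≤ Fintype.card V := by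
      have h1 : 1 * t ≤ (r * t) * t := Nat.mul_le_mul_right _ hm
      have h2 : r * t ^ 2 = r * t * t := by ring
      omega
    have hdeg := hT.hmaxDegree_thickClique ht1 (r * t - 1) htV
    rwa [Nat.sub_add_cancel hm] at hdeg
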